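/- Let $\Sigma$ be a punctured surface of finite type in its compact form, i.e. a compact connected smooth surface with boundary which is homeomorphic to a closed connected orientable surface with finitely many (at least one) disjoint open discs removed (equivalently, to a closed disc with finitely many disjoint boundary arcs glued in pairs by orientation-reversing maps). Let $\varphi:\Sigma\to\Sigma$ be a $C^\infty$ diffeomorphism and let $N=\Sigma\times\mathbb R/\big((x,t+1)\sim(\varphi(x),t)\big)$ be the smooth surface bundle over $S^1$ with fibre $\Sigma$ and monodromy $\varphi$; thus $N$ is $\Sigma\times I$, $I=[0,1]$, with $(x,1)$ glued to $(\varphi(x),0)$. Let $x_0\in\Sigma$ and let $\rho:\pi_1(\Sigma,x_0)\to\mathrm{Homeo}(I)$ be a representation by orientation-preserving homeomorphisms. Call $\rho$ *generic* if for each nontrivial $\alpha\in\pi_1(\Sigma,x_0)$ the fixed points of $\rho(\alpha)$ in the interior of $I$ are isolated, and *well-tapered* if it is generic and its image consists of $C^\infty$ diffeomorphisms of $I$ that are infinitely tangent to the identity at both endpoints. A codimension one foliation (transverse to the boundary) is *typical* if for each leaf $\lambda$ the holonomy cover of $\lambda$, i.e. the connected covering of $\lambda$ corresponding to the kernel of the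 holonomy homomorphism from $\pi_1(\lambda)$ to germs of homeomorphisms of a transversal, is contractible. Suppose $\rho$ is generic. Then there is a typical codimension one topological foliation $\mathscr F_\rho$ of $N$ which on $\Sigma\times I$ is the suspension of $\rho$: for every path $c$ in $\Sigma$ and every $\theta\in I$ there is exactly one path $u$ in $I$ with $u(0)=\theta$ such that $s\mapsto (c(s),u(s))$ is tangent to $\mathscr F_\rho$, and if $c$ is a loop at $x_0$ in the class $\alpha$, then $u(1)=\rho(\alpha)(\theta)$. (Here the product $\alpha\beta$ in $\pi_1(\Sigma,x_0)$ is the loop $\beta$ followed by the loop $\alpha$.) If $\rho$ is well-tapered, $\mathscr F_\rho$ can moreover be chosen to be $C^\infty$. -/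

import Mathlib

open Set Filter Topology
open scoped Manifold ContDiff unitInterval

universe u

noncomputable section

/-! ## Punctured surfaces -/

/-- The rectangle `[0, 2m+1] × [0, 1]`.  On its top edge it carries the `m` pairwise disjoint closed
arcs `[2i+1, 2i+2] × {1}`, `i < m`. -/
def discWithArcs (m : ℕ) : Set (ℝ × ℝ) :=
  Icc (0 : ℝ) (2 * m + 1) ×ˢ Icc (0 : ℝ) 1

/-- The elementary identifications: the `i`-th arc is glued to the `τ i`-th arc by the
orientation-reversing isometry. -/
def arcGluing {m : ℕ} (τ : Fin m → Fin m) (a b : discWithArcs m) : Prop :=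
  ∃ (i : Fin m) (s : ℝ), s ∈ Icc (0 : ℝ) 1 ∧
    (a : ℝ × ℝ) = (2 * ((i : ℕ) : ℝ) + 1 + s, 1) ∧
    (b : ℝ × ℝ) = (2 * ((τ i : ℕ) : ℝ) + 2 - s, 1)

/-- A polygon with truncated corners whose sides are glued in pairs (with the quotient topology). -/
abbrev GluedDisc {m : ℕ} (τ : Fin m → Fin m) : Type := Quot (arcGluing τ)

/-- `S` is a punctured surface of finite type, in its compact form: a closed connected orientable
surface from which a positive number of disjoint open discs has been removed.  These are exactly the
spaces obtained from a disc by gluing finitely many disjoint boundary arcs in pairs, reversing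
orientation (`m = 0` is the disc; `m = 4g` with the pattern `a b a⁻¹ b⁻¹ ⋯` is the usual polygon of
the closed surface of genus `g`, with a disc around the vertex removed). -/
def IsPuncturedSurface (S : Type*) [TopologicalSpace S] : Prop :=
  ∃ (m : ℕ) (τ : Fin m → Fin m), (∀ i, τ (τ i) = i) ∧ (∀ i, τ i ≠ i) ∧ Nonempty (S ≃ₜ GluedDisc τ)

/-! ## Surface bundles over the circle -/

/-- The local model of a surface with boundary times a line. -/
abbrev HalfSpaceProd : Type := ModelProd (EuclideanHalfSpace 2) ℝ

/-- `q : S × ℝ → N` exhibits the smooth manifold `N` as the mapping torus of `φ`, that is, as the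
surface bundle over the circle with fibre `S` and monodromy `φ`: the manifold `N` is the quotient of
`S × ℝ` by the action of `ℤ` generated by `(x, t + 1) ∼ (φ x, t)`. In particular `N` is
`S × [0, 1]` with `(x, 1)` glued to `(φ x, 0)`. -/
structure IsMappingTorus {S N : Type*} [TopologicalSpace S] [ChartedSpace (EuclideanHalfSpace 2) S]
    [TopologicalSpace N] [ChartedSpace HalfSpaceProd N]
    (φ : S ≃ₘ^∞⟮𝓡∂ 2, 𝓡∂ 2⟯ S) (q : S × ℝ → N) : Prop where
  surjective : Function.Surjective q
  localDiffeo : IsLocalDiffeomorph ((𝓡∂ 2).prod 𝓘(ℝ, ℝ)) ((𝓡∂ 2).prod 𝓘(ℝ, ℝ)) ∞ q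
  eq_iff : ∀ (x y : S) (t s : ℝ), q (x, t) = q (y, s) ↔
    ∃ n : ℤ, y = ((φ.toEquiv : Equiv.Perm S) ^ n) x ∧ s = t - n

/-! ## Representations in the homeomorphisms of the interval -/

/-- For each nontrivial `γ`, the fixed points of `ρ γ` in the interior of `I` are isolated. -/
def IsGeneric {G : Type*} [Group G] (ρ : G →* (I ≃ₜ I)) : Prop :=
  ∀ γ : G, γ ≠ 1 → ∀ θ : I, 0 < θ → θ < 1 → ρ γ θ = θ → ∀ᶠ θ' in 𝓝[≠] θ, ρ γ θ' ≠ θ'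

/-- A self-homeomorphism of `I` as a real function (constant outside `I`). -/
def realExtension (g : I ≃ₜ I) (t : ℝ) : ℝ := (g (projIcc 0 1 zero_le_one t) : ℝ)

/-- `g` is a `C^∞` diffeomorphism of `I`, infinitely tangent to the identity at both endpoints. -/
structure IsTaperedDiffeo (g : I ≃ₜ I) : Prop where
  smooth : ContDiffOn ℝ ∞ (realExtension g) (Icc 0 1)
  smooth_symm : ContDiffOn ℝ ∞ (realExtension g.symm) (Icc 0 1)
  tangent_zero : ∀ n : ℕ, iteratedDerivWithin n (fun t => realExtension g t - t) (Icc 0 1) 0 = 0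
  tangent_one : ∀ n : ℕ, iteratedDerivWithin n (fun t => realExtension g t - t) (Icc 0 1) 1 = 0

/-- A generic representation by `C^∞` diffeomorphisms infinitely tangent to the identity at the
endpoints. -/
def IsWellTapered {G : Type*} [Group G] (ρ : G →* (I ≃ₜ I)) : Prop :=
  IsGeneric ρ ∧ ∀ γ, IsTaperedDiffeo (ρ γ)

/-! ## Surface foliations of three-manifolds -/

/-- A (topological) codimension one foliation of a three-manifold, transverse to its boundary, given
by an atlas of foliated charts: the changes of charts have locally the form
`(x, t) ↦ (f (x, t), h t)`. -/
structure SurfaceFoliation (N : Type*) [TopologicalSpace N] where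
  charts : Set (OpenPartialHomeomorph N HalfSpaceProd)
  cover : ∀ x : N, ∃ e ∈ charts, x ∈ e.source
  compatible : ∀ e ∈ charts, ∀ e' ∈ charts, ∀ x ∈ e.source ∩ e'.source,
    ∃ h : ℝ → ℝ, ∀ᶠ y in 𝓝 x, (e' y).2 = h (e y).2

namespace SurfaceFoliation

section TopologicalPart

variable {N : Type*} [TopologicalSpace N]

/-- The leaf topology: it is generated by the open subsets of the plaques
`{y ∈ e.source | (e y).2 = t}`. -/
@[reducible] def leafTopology (F : SurfaceFoliation N) : TopologicalSpace N :=
  TopologicalSpace.generateFrom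
    {W | ∃ e ∈ F.charts, ∃ (t : ℝ) (V : Set N), IsOpen V ∧
      W = {y | y ∈ e.source ∧ (e y).2 = t ∧ y ∈ V}}

/-- The manifold `N` with the leaf topology. -/
def LeafSpace (_F : SurfaceFoliation N) : Type _ := N

instance (F : SurfaceFoliation N) : TopologicalSpace F.LeafSpace := F.leafTopology

/-- The leaf through `x`; as a type it carries the leaf topology. -/
def leaf (F : SurfaceFoliation N) (x : N) : Set F.LeafSpace :=
  pathComponent (X := F.LeafSpace) x

/-- The path `c` is tangent to the foliation (that is, continuous for the leaf topology). -/
def IsLeafwise (F : SurfaceFoliation N) (c : I → N) : Prop :=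
  Continuous (Y := F.LeafSpace) c

/-- The germ at `(e (c 0)).2` of `g` is the holonomy of `F` along the leafwise path `c`, between the
transversal through `c 0` that is vertical in the chart `e` and the transversal through `c 1` that
is vertical in the chart `e'`: the path `c` can be moved to nearby leaves by a
continuous family `H (·, t)` of leafwise paths starting at the point of height `t` of the first
transversal and ending at the point of height `g t` of the second one. -/
def HasHolonomy (F : SurfaceFoliation N) (c : I → N) (e e' : OpenPartialHomeomorph N HalfSpaceProd)
    (g : ℝ → ℝ) : Prop :=
  ∃ δ > (0 : ℝ), ∃ H : I × ℝ → N,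
    ContinuousOn H (univ ×ˢ Metric.ball (e (c 0)).2 δ) ∧
    (∀ s, H (s, (e (c 0)).2) = c s) ∧
    ∀ t ∈ Metric.ball (e (c 0)).2 δ,
      F.IsLeafwise (fun s => H (s, t)) ∧
      (((e (c 0)).1, t) ∈ e.target ∧ H (0, t) = e.symm ((e (c 0)).1, t)) ∧
      (((e' (c 1)).1, g t) ∈ e'.target ∧ H (1, t) = e'.symm ((e' (c 1)).1, g t))

/-- The leafwise loop `c` lies in the kernel of the holonomy homomorphism: its holonomy on a
transversal through `c 0` is the germ of the identity. -/
def HasTrivialHolonomy (F : SurfaceFoliation N) (c : I → N) : Prop :=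
  ∃ e ∈ F.charts, c 0 ∈ e.source ∧ F.HasHolonomy c e e id

/-- `pr : E → λ` is the holonomy cover of the leaf `λ` through `x`: the connected covering which
corresponds to the kernel of the holonomy homomorphism, that is, a loop in the leaf lifts to a closed
loop in `E` if and only if its holonomy is trivial. -/
structure IsHolonomyCover (F : SurfaceFoliation N) (x : N) {E : Type*} [TopologicalSpace E]
    (pr : E → F.leaf x) : Prop where
  isCoveringMap : IsCoveringMap pr
  pathConnected : PathConnectedSpace E
  closed_iff : ∀ Γ : C(I, E), pr (Γ 0) = pr (Γ 1) →
    (Γ 0 = Γ 1 ↔ F.HasTrivialHolonomy (fun s => ((pr (Γ s) : F.LeafSpace) : N)))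

/-- A foliation is typical if the holonomy cover of each leaf is contractible. -/
def IsTypical {N : Type u} [TopologicalSpace N] (F : SurfaceFoliation N) : Prop :=
  ∀ x : N, ∃ (E : Type u) (_ : TopologicalSpace E) (pr : E → F.leaf x),
    F.IsHolonomyCover x pr ∧ ContractibleSpace E

/-- Cutting the mapping torus `N` open along the fibre `q (S × {0})` turns `F` into the suspension of
`ρ` on `S × I`, that is, into the foliation transverse to the intervals `{x} × I` with holonomy
representation `ρ`: through each point over `c 0` there is exactly one leafwise lift to `S × I` of a
path `c` in `S`, and the lift of a loop `γ` at `x₀` that starts at height `θ` ends at height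
`ρ γ θ`.  (In Mathlib the product `γ * γ'` in the fundamental group is `γ'` followed by `γ`, so that
this is a left action.) -/
structure IsSuspension {S : Type*} [TopologicalSpace S] (F : SurfaceFoliation N) (q : S × ℝ → N)
    {x₀ : S} (ρ : FundamentalGroup S x₀ →* (I ≃ₜ I)) : Prop where
  existsUnique_lift : ∀ (c : C(I, S)) (θ : I), ∃! u : C(I, I),
    u 0 = θ ∧ F.IsLeafwise (fun s => q (c s, (u s : ℝ)))
  holonomy : ∀ (γ : Path x₀ x₀) (u : C(I, I)), F.IsLeafwise (fun s => q (γ s, (u s : ℝ))) →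
    u 1 = ρ (FundamentalGroup.fromPath (Path.Homotopic.Quotient.mk γ)) (u 0)

end TopologicalPart

/-- A foliation of a smooth manifold is `C^∞` if its foliated charts are smooth charts. -/
def IsSmooth {N : Type*} [TopologicalSpace N] [ChartedSpace HalfSpaceProd N]
    (F : SurfaceFoliation N) : Prop :=
  ∀ e ∈ F.charts, e ∈ IsManifold.maximalAtlas ((𝓡∂ 2).prod 𝓘(ℝ, ℝ)) ∞ N

end SurfaceFoliation

end

/-! The surface $\Sigma$ is the quotient of a contractible space $E$ by a free group $G$: copies of
the disc, one for each element of $G$, are glued along the Cayley tree, and the tree of discs is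
collapsed from its far ends towards the root (`contractibleSpace_treeCover`). Since
$\pi_1(\Sigma,x_0)$ is the opposite group of $G$, the representation $\rho$ becomes an action
$\kappa$ of $G$ on $I$.

The suspension is the quotient of $E\times I$, foliated by the slices $E\times\{t\}$, by the
diagonal action. To see it on $\Sigma\times I$ one needs increasing homeomorphisms $H_e$ of $I$,
depending continuously on $e\in E$, with $H_{ge}\circ\kappa(g)=H_e$. They are averages of the maps
$\kappa(g)$ with weights from a partition of unity on $\Sigma$ (`fiberHeight`, `fiberHeight_smul`):
a convex combination of increasing homeomorphisms is again one. The normalization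
$H_{e_0}=\mathrm{id}$ makes the holonomy equal to $\rho$ rather than only conjugate to it.

All these maps fix the endpoints of $I$, so they can be stacked: over $[n,n+1]$ one uses $H_{\psi^n
e}$, where $\psi$ lifts $\varphi$ to $E$. This gives a local homeomorphism $E\times\mathbb R\to N$
whose identifications come from $G$ and $\psi$ and preserve the product foliation
(`isFoliatedCover_developingMap`), which therefore descends to $N$. Leafwise paths are those that
lift to constant height (`eq_of_isLeafwise`), whence the suspension property.

An identification involving $\psi^n$ changes the integer part of the height by $n$, so only elements
of $G$ can fix a height $t$. The leaf at height $t$ is thus $E/G_t$, and the holonomy of $g\in G_t$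
is its germ on heights at $t$. By genericity this germ is trivial only for $g=1$, also at integers,
where it suffices to look just above $t$. Hence the holonomy cover is $E$ itself
(`hasTrivialHolonomy_iff`, `isTypical`).

If $\rho$ is well-tapered, flatness at the endpoints makes the extensions by the identity smooth,
and the averages have positive derivative. The heights and their inverses are then smooth over
$\Sigma$, hence so are the foliated charts (`isSmooth_foliation`). -/

noncomputable section

/-! ## The glued disc -/

/-- The point with parameter `s` on the `i`-th boundary arc of the rectangle. -/
def arcPoint {m : ℕ} (i : Fin m) (s : I) : discWithArcs m :=
  ⟨(2 * ((i : ℕ) : ℝ) + 1 + s, 1), by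
    have hi : ((i : ℕ) : ℝ) + 1 ≤ m := by exact_mod_cast i.2
    have h0 := s.2.1
    have h1 := s.2.2
    have hp : (0 : ℝ) ≤ ((i : ℕ) : ℝ) := by positivity
    simp only [discWithArcs, mem_prod, mem_Icc]
    refine ⟨⟨by linarith, by linarith⟩, by norm_num, le_refl _⟩⟩

@[simp] lemma arcPoint_fst {m : ℕ} (i : Fin m) (s : I) :
    (arcPoint i s).1.1 = 2 * ((i : ℕ) : ℝ) + 1 + s := rfl

@[simp] lemma arcPoint_snd {m : ℕ} (i : Fin m) (s : I) : (arcPoint i s).1.2 = 1 := rfl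

/-- A vertical strip around the `i`-th arc. -/
def arcStrip {m : ℕ} (i : Fin m) : Set (discWithArcs m) :=
  {a | a.1.1 ∈ Ioo (2 * ((i : ℕ) : ℝ) + 1 / 2) (2 * ((i : ℕ) : ℝ) + 5 / 2)}

lemma isOpen_arcStrip {m : ℕ} (i : Fin m) : IsOpen (arcStrip i) :=
  isOpen_Ioo.preimage (continuous_fst.comp continuous_subtype_val)

lemma eq_of_mem_arcStrip {m : ℕ} {i j : Fin m} {a : discWithArcs m}
    (hi : a ∈ arcStrip i) (hj : a ∈ arcStrip j) : i = j := by
  obtain ⟨h1, h2⟩ := hi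
  obtain ⟨h3, h4⟩ := hj
  have h5 : ((i : ℕ) : ℝ) < (j : ℕ) + 1 := by linarith
  have h6 : ((j : ℕ) : ℝ) < (i : ℕ) + 1 := by linarith
  have h7 : (i : ℕ) < j + 1 := by exact_mod_cast h5
  have h8 : (j : ℕ) < i + 1 := by exact_mod_cast h6
  exact Fin.ext (by omega)

lemma arcPoint_mem_arcStrip {m : ℕ} (i : Fin m) (s : I) : arcPoint i s ∈ arcStrip i := by
  have h0 := s.2.1
  have h1 := s.2.2
  constructor <;> simp only [arcPoint_fst] <;> linarith

lemma arcPoint_inj {m : ℕ} {i j : Fin m} {s t : I} :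
    arcPoint i s = arcPoint j t ↔ i = j ∧ s = t := by
  refine ⟨fun h => ?_, by rintro ⟨rfl, rfl⟩; rfl⟩
  have hij : i = j :=
    eq_of_mem_arcStrip (arcPoint_mem_arcStrip i s) (h ▸ arcPoint_mem_arcStrip j t)
  subst hij
  refine ⟨rfl, Subtype.ext ?_⟩
  have := congrArg (fun a : discWithArcs m => a.1.1) h
  simpa using this

lemma continuous_arcPoint {m : ℕ} (i : Fin m) : Continuous (arcPoint i) := by
  unfold arcPoint
  fun_prop

lemma arcGluing_iff {m : ℕ} {τ : Fin m → Fin m} {a b : discWithArcs m} :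
    arcGluing τ a b ↔ ∃ i s, a = arcPoint i s ∧ b = arcPoint (τ i) (σ s) := by
  constructor
  · rintro ⟨i, s, hs, ha, hb⟩
    refine ⟨i, ⟨s, hs⟩, Subtype.ext ha, Subtype.ext (hb.trans ?_)⟩
    ext
    · simp only [arcPoint_fst, unitInterval.coe_symm_eq]; ring
    · simp
  · rintro ⟨i, s, rfl, rfl⟩
    refine ⟨i, s, s.2, rfl, ?_⟩
    ext
    · simp only [arcPoint_fst, unitInterval.coe_symm_eq]; ring
    · simp

section Gluing

variable {m : ℕ} {τ : Fin m → Fin m}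

/-- The gluing is an involution on the points of the disjoint arcs, so two consecutive gluings
cancel and the generated equivalence relation has no longer chains. -/
lemma gluedDisc_mk_eq_iff (hτ : ∀ i, τ (τ i) = i) {a b : discWithArcs m} :
    (Quot.mk _ a : GluedDisc τ) = Quot.mk _ b ↔ a = b ∨ arcGluing τ a b := by
  constructor
  · intro h
    have h' := Quot.eqvGen_exact h
    induction h' with
    | rel x y hxy => exact Or.inr hxy
    | refl x => exact Or.inl rfl
    | symm x y _ ih =>
      rcases ih (Quot.eqvGen_sound ‹_›) with rfl | ih
      · exact Or.inl rfl
      · rw [arcGluing_iff] at ih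
        obtain ⟨i, s, rfl, rfl⟩ := ih
        exact Or.inr (arcGluing_iff.2 ⟨τ i, σ s, rfl, by rw [hτ, unitInterval.symm_symm]⟩)
    | trans x y z _ _ ih1 ih2 =>
      rcases ih1 (Quot.eqvGen_sound ‹_›) with rfl | ih1
      · exact ih2 h
      rcases ih2 (Quot.eqvGen_sound ‹_›) with rfl | ih2
      · exact Or.inr ih1
      rw [arcGluing_iff] at ih1 ih2
      obtain ⟨i, s, rfl, hy⟩ := ih1
      obtain ⟨j, t, hy', rfl⟩ := ih2
      obtain ⟨rfl, rfl⟩ := arcPoint_inj.1 (hy.symm.trans hy')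
      exact Or.inl (by rw [hτ, unitInterval.symm_symm])
  · rintro (rfl | h)
    · rfl
    · exact Quot.sound h

instance : CompactSpace (discWithArcs m) :=
  isCompact_iff_compactSpace.1 (isCompact_Icc.prod isCompact_Icc)

instance : CompactSpace (GluedDisc τ) := Quot.compactSpace

/-- A function of the first coordinate which is `1` on the `i`-th arc and vanishes on the others. -/
def arcBump {m : ℕ} (i : Fin m) (a : discWithArcs m) : ℝ :=
  max 0 (1 - 2 * max 0 (max (2 * ((i : ℕ) : ℝ) + 1 - a.1.1) (a.1.1 - (2 * ((i : ℕ) : ℝ) + 2))))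

lemma continuous_arcBump (i : Fin m) : Continuous (arcBump i) := by
  unfold arcBump
  fun_prop

lemma arcBump_arcPoint (i j : Fin m) (s : I) :
    arcBump i (arcPoint j s) = if i = j then 1 else 0 := by
  have h0 := s.2.1
  have h1 := s.2.2
  unfold arcBump
  rw [arcPoint_fst]
  split_ifs with h
  · subst h
    rw [max_eq_left (b := max _ _) (max_le (by linarith) (by linarith))]
    norm_num
  · refine max_eq_left ?_
    have hij : (i : ℕ) ≠ j := fun h' => h (Fin.ext h')
    rcases lt_or_gt_of_ne hij with h' | h'
    · have : ((i : ℕ) : ℝ) + 1 ≤ (j : ℕ) := by exact_mod_cast h'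
      have h2 : (1 : ℝ) ≤ max 0 (max (2 * ((i : ℕ) : ℝ) + 1 - (2 * ((j : ℕ) : ℝ) + 1 + s))
          (2 * ((j : ℕ) : ℝ) + 1 + s - (2 * ((i : ℕ) : ℝ) + 2))) :=
        le_max_of_le_right (le_max_of_le_right (by linarith))
      linarith
    · have : ((j : ℕ) : ℝ) + 1 ≤ (i : ℕ) := by exact_mod_cast h'
      have h2 : (1 : ℝ) ≤ max 0 (max (2 * ((i : ℕ) : ℝ) + 1 - (2 * ((j : ℕ) : ℝ) + 1 + s))
          (2 * ((j : ℕ) : ℝ) + 1 + s - (2 * ((i : ℕ) : ℝ) + 2))) :=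
        le_max_of_le_right (le_max_of_le_left (by linarith))
      linarith

lemma arcBump_eq_one_iff {i : Fin m} {a : discWithArcs m} (ha : a.1.2 = 1) :
    arcBump i a = 1 ↔ ∃ s, a = arcPoint i s := by
  constructor
  · intro h
    have h1 : max 0 (max (2 * ((i : ℕ) : ℝ) + 1 - a.1.1)
        (a.1.1 - (2 * ((i : ℕ) : ℝ) + 2))) ≤ 0 := by
      by_contra! h2
      have h3 : arcBump i a < 1 := max_lt (by norm_num) (by linarith)
      linarith
    have h2 := (le_max_left _ _).trans ((le_max_right _ _).trans h1)
    have h3 := (le_max_right _ _).trans ((le_max_right _ _).trans h1)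
    refine ⟨⟨a.1.1 - (2 * ((i : ℕ) : ℝ) + 1), by constructor <;> linarith⟩, Subtype.ext ?_⟩
    ext
    · simp
    · simpa using ha
  · rintro ⟨s, rfl⟩
    simp [arcBump_arcPoint]

/-- A nonnegative function vanishing exactly on the boundary arcs. -/
def arcDefect (a : discWithArcs m) : ℝ :=
  max (1 - a.1.2) (∏ i, (1 - arcBump i a))

lemma continuous_arcDefect : Continuous (arcDefect (m := m)) := by
  unfold arcDefect
  have h := fun i : Fin m => continuous_arcBump i
  fun_prop

@[simp] lemma arcDefect_arcPoint (i : Fin m) (s : I) : arcDefect (arcPoint i s) = 0 := by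
  unfold arcDefect
  rw [Finset.prod_eq_zero (Finset.mem_univ i) (by simp [arcBump_arcPoint])]
  simp

lemma arcDefect_eq_zero_iff {a : discWithArcs m} : arcDefect a = 0 ↔ ∃ i s, a = arcPoint i s := by
  constructor
  · intro h
    have hy : a.1.2 = 1 :=
      le_antisymm a.2.2.2 (by linarith [(le_max_left _ _).trans h.le])
    have h0 : ∀ i, 0 ≤ 1 - arcBump i a := fun i => by
      have : arcBump i a ≤ 1 := max_le (by norm_num)
        (by linarith [le_max_left 0 (max (2 * ((i : ℕ) : ℝ) + 1 - a.1.1)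
          (a.1.1 - (2 * ((i : ℕ) : ℝ) + 2)))])
      linarith
    have hp : ∏ i, (1 - arcBump i a) = 0 :=
      le_antisymm ((le_max_right _ _).trans h.le) (Finset.prod_nonneg fun i _ => h0 i)
    obtain ⟨i, -, hi⟩ := Finset.prod_eq_zero_iff.1 hp
    exact ⟨i, (arcBump_eq_one_iff hy).1 (by linarith)⟩
  · rintro ⟨i, s, rfl⟩
    simp

/-- Continuous functions on the rectangle compatible with the gluing; they separate the points of
the glued disc. -/
def gluingCoordinates (τ : Fin m → Fin m) (a : discWithArcs m) :
    ℝ × ℝ × ℝ × (Fin m → ℝ) × (Fin m → ℝ) :=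
  (arcDefect a, arcDefect a * a.1.1, arcDefect a * a.1.2,
    (fun i => arcBump i a + arcBump (τ i) a),
    (fun i => arcBump i a * (a.1.1 - (2 * ((i : ℕ) : ℝ) + 1)) +
      arcBump (τ i) a * (2 * ((τ i : ℕ) : ℝ) + 2 - a.1.1)))

lemma continuous_gluingCoordinates : Continuous (gluingCoordinates τ) := by
  unfold gluingCoordinates
  have h := fun i : Fin m => continuous_arcBump i
  have h' := continuous_arcDefect (m := m)
  fun_prop

lemma gluingCoordinates_eq_of_arcGluing (hτ : ∀ i, τ (τ i) = i) (hτ' : ∀ i, τ i ≠ i)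
    {a b : discWithArcs m} (h : arcGluing τ a b) :
    gluingCoordinates τ a = gluingCoordinates τ b := by
  obtain ⟨i, s, rfl, rfl⟩ := arcGluing_iff.1 h
  have hinv : ∀ j, τ j = i ↔ j = τ i := fun j =>
    ⟨fun h => by rw [← h, hτ], fun h => by rw [h, hτ]⟩
  have hinv' : ∀ j, τ j = τ i ↔ j = i := fun j =>
    ⟨fun h => by rw [← hτ j, h, hτ], fun h => by rw [h]⟩
  simp only [gluingCoordinates, arcDefect_arcPoint, zero_mul, Prod.mk.injEq, true_and,
    arcBump_arcPoint, hinv, hinv', arcPoint_fst, unitInterval.coe_symm_eq]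
  constructor
  · funext j
    ring
  · funext j
    by_cases h1 : j = i
    · subst h1
      simp only [if_true, (hτ' j).symm, if_false]
      ring
    · by_cases h2 : j = τ i
      · subst h2
        simp only [if_true, (hτ' i), if_false, hτ]
        ring
      · simp [h1, h2]

/-- Off the arcs, division by the nonzero defect recovers the point. On the arcs, the sums of bumps
determine the pair of arcs, and the last coordinates the common parameter. -/
lemma arcGluing_of_gluingCoordinates_eq (hτ' : ∀ i, τ i ≠ i) {a b : discWithArcs m}
    (h : gluingCoordinates τ a = gluingCoordinates τ b) : a = b ∨ arcGluing τ a b := by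
  simp only [gluingCoordinates, Prod.mk.injEq] at h
  obtain ⟨h1, h2, h3, h4, h5⟩ := h
  by_cases ha : arcDefect a = 0
  · have hb : arcDefect b = 0 := h1 ▸ ha
    obtain ⟨i, s, rfl⟩ := arcDefect_eq_zero_iff.1 ha
    obtain ⟨j, t, rfl⟩ := arcDefect_eq_zero_iff.1 hb
    have h4' := congrFun h4 i
    have h5' := congrFun h5 i
    simp only [arcBump_arcPoint, arcPoint_fst] at h4' h5'
    by_cases hi : i = j
    · subst hi
      refine Or.inl (arcPoint_inj.2 ⟨rfl, Subtype.ext ?_⟩)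
      simp only [if_true, hτ' i, if_false] at h5'
      linarith
    · by_cases hj : τ i = j
      · subst hj
        refine Or.inr (arcGluing_iff.2 ⟨i, s, rfl, arcPoint_inj.2 ⟨rfl, Subtype.ext ?_⟩⟩)
        rw [unitInterval.coe_symm_eq]
        simp only [if_true, hi, if_false, hτ' i] at h5'
        linarith
      · simp only [if_true, hi, hj, if_false] at h4'
        split_ifs at h4' <;> norm_num at h4'
  · rw [← h1] at h2 h3
    exact Or.inl (Subtype.ext (Prod.ext (mul_left_cancel₀ ha h2) (mul_left_cancel₀ ha h3)))

lemma gluedDisc_t2Space (hτ : ∀ i, τ (τ i) = i) (hτ' : ∀ i, τ i ≠ i) : T2Space (GluedDisc τ) := by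
  let f : GluedDisc τ → ℝ × ℝ × ℝ × (Fin m → ℝ) × (Fin m → ℝ) :=
    Quot.lift (gluingCoordinates τ) fun _ _ h => gluingCoordinates_eq_of_arcGluing hτ hτ' h
  have hf : Continuous f := isQuotientMap_quot_mk.continuous_iff.2 continuous_gluingCoordinates
  refine T2Space.of_injective_continuous (f := f) ?_ hf
  rintro ⟨a⟩ ⟨b⟩ h
  exact (gluedDisc_mk_eq_iff hτ).2 (arcGluing_of_gluingCoordinates_eq hτ' h)

end Gluing

/-! ## The universal covering of the glued disc -/

section TreeCover

variable {m : ℕ}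

/-- One generator for each pair of arcs glued by `τ`. -/
abbrev ArcPair (τ : Fin m → Fin m) : Type := {i : Fin m // i < τ i}

variable {τ : Fin m → Fin m}

/-- The arc through which a letter leaves the disc. -/
def letterArc (l : ArcPair τ × Bool) : Fin m := if l.2 then l.1.1 else τ l.1.1

/-- The formal inverse of a letter. -/
def letterInv (l : ArcPair τ × Bool) : ArcPair τ × Bool := (l.1, !l.2)

@[simp] lemma letterInv_letterInv (l : ArcPair τ × Bool) : letterInv (letterInv l) = l := by
  simp [letterInv]

lemma letterArc_letterInv (hτ : ∀ i, τ (τ i) = i) (l : ArcPair τ × Bool) :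
    letterArc (letterInv l) = τ (letterArc l) := by
  rcases l with ⟨i, _ | _⟩ <;> simp [letterArc, letterInv, hτ]

lemma letterArc_injective (hτ : ∀ i, τ (τ i) = i) :
    Function.Injective (letterArc (τ := τ)) := by
  rintro ⟨⟨i, hi⟩, _ | _⟩ ⟨⟨j, hj⟩, _ | _⟩ h <;> simp only [letterArc, if_true, if_false,
    Bool.false_eq_true] at h
  · have : i = j := by rw [← hτ i, h, hτ]
    subst this; rfl
  · subst h
    rw [hτ] at hj
    exact absurd hj hi.not_gt
  · subst h
    rw [hτ] at hi
    exact absurd hi hj.not_gt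
  · subst h; rfl

lemma letterArc_surjective (hτ : ∀ i, τ (τ i) = i) (hτ' : ∀ i, τ i ≠ i) :
    Function.Surjective (letterArc (τ := τ)) := by
  intro i
  rcases lt_or_gt_of_ne (hτ' i) with h | h
  · exact ⟨(⟨τ i, by rwa [hτ]⟩, false), by simp [letterArc, hτ]⟩
  · exact ⟨(⟨i, h⟩, true), by simp [letterArc]⟩

/-- The element of the free group given by a letter. -/
def letterElt (l : ArcPair τ × Bool) : FreeGroup (ArcPair τ) := FreeGroup.mk [l]

lemma letterElt_letterInv (l : ArcPair τ × Bool) : letterElt (letterInv l) = (letterElt l)⁻¹ := by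
  simp [letterElt, letterInv, FreeGroup.inv_mk, FreeGroup.invRev]

lemma letterElt_mul_mk (l : ArcPair τ × Bool) (L : List (ArcPair τ × Bool)) :
    letterElt l * FreeGroup.mk L = FreeGroup.mk (l :: L) := by
  simp [letterElt, FreeGroup.mul_mk]

/-- The disjoint union of copies of the rectangle, indexed by the free group. -/
abbrev Sheets (τ : Fin m → Fin m) : Type := Σ _ : FreeGroup (ArcPair τ), discWithArcs m

/-- The arc of a letter `l` on the sheet `w` is glued to the inverse arc on the sheet `l w`. -/
def sheetGluing (p q : Sheets τ) : Prop :=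
  ∃ (l : ArcPair τ × Bool) (s : I), p.2 = arcPoint (letterArc l) s ∧
    q.2 = arcPoint (letterArc (letterInv l)) (σ s) ∧ q.1 = letterElt l * p.1

lemma sheetGluing.symm {p q : Sheets τ} (h : sheetGluing p q) : sheetGluing q p := by
  obtain ⟨l, s, h1, h2, h3⟩ := h
  exact ⟨letterInv l, σ s, h2, by simpa using h1, by rw [h3, letterElt_letterInv]; group⟩

lemma sheetGluing.arcGluing (hτ : ∀ i, τ (τ i) = i) {p q : Sheets τ} (h : sheetGluing p q) :
    arcGluing τ p.2 q.2 := by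
  obtain ⟨l, s, h1, h2, -⟩ := h
  exact arcGluing_iff.2 ⟨_, s, h1, by rw [h2, letterArc_letterInv hτ]⟩

/-- Discs glued along a tree. -/
abbrev TreeCover (τ : Fin m → Fin m) : Type := Quot (sheetGluing (τ := τ))

lemma treeCover_mk_eq_iff (hτ : ∀ i, τ (τ i) = i) {p q : Sheets τ} :
    (Quot.mk _ p : TreeCover τ) = Quot.mk _ q ↔ p = q ∨ sheetGluing p q := by
  constructor
  · intro h
    have h' := Quot.eqvGen_exact h
    induction h' with
    | rel x y hxy => exact Or.inr hxy
    | refl x => exact Or.inl rfl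
    | symm x y _ ih =>
      rcases ih (Quot.eqvGen_sound ‹_›) with rfl | ih
      · exact Or.inl rfl
      · exact Or.inr ih.symm
    | trans x y z _ _ ih1 ih2 =>
      rcases ih1 (Quot.eqvGen_sound ‹_›) with rfl | ih1
      · exact ih2 h
      rcases ih2 (Quot.eqvGen_sound ‹_›) with rfl | ih2
      · exact Or.inr ih1
      obtain ⟨l, s, hx, hy, hxy⟩ := ih1
      obtain ⟨l', t, hy', hz, hyz⟩ := ih2
      obtain ⟨hl, rfl⟩ := arcPoint_inj.1 (hy.symm.trans hy')
      have := letterArc_injective hτ hl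
      subst this
      refine Or.inl (Sigma.ext ?_ (heq_of_eq ?_))
      · rw [hyz, hxy, letterElt_letterInv]; group
      · rw [hx, hz]; simp
  · rintro (rfl | h)
    · rfl
    · exact Quot.sound h

lemma continuous_sheetMk (w : FreeGroup (ArcPair τ)) :
    Continuous fun a : discWithArcs m => (⟨w, a⟩ : Sheets τ) :=
  @continuous_sigmaMk _ (fun _ => discWithArcs m) _ w

/-- Translation of the sheets. -/
def sheetTranslate (g : FreeGroup (ArcPair τ)) (p : Sheets τ) : Sheets τ := ⟨p.1 * g⁻¹, p.2⟩

lemma continuous_sheetTranslate (g : FreeGroup (ArcPair τ)) : Continuous (sheetTranslate g) :=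
  continuous_sigma fun w => continuous_sheetMk (w * g⁻¹)

/-- Sheets are glued by left multiplication and translated by right multiplication, and these
commute. -/
lemma sheetGluing_translate (g : FreeGroup (ArcPair τ)) {p q : Sheets τ} (h : sheetGluing p q) :
    sheetGluing (sheetTranslate g p) (sheetTranslate g q) := by
  obtain ⟨l, s, h1, h2, h3⟩ := h
  exact ⟨l, s, h1, h2, by simp only [sheetTranslate, h3, mul_assoc]⟩

instance : MulAction (FreeGroup (ArcPair τ)) (TreeCover τ) where
  smul g := Quot.map (sheetTranslate g) fun _ _ => sheetGluing_translate g
  one_smul := by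
    rintro ⟨p⟩
    change Quot.mk _ (sheetTranslate 1 p) = _
    simp [sheetTranslate]
  mul_smul := by
    rintro g h ⟨p⟩
    change Quot.mk _ (sheetTranslate (g * h) p) = Quot.mk _ (sheetTranslate g (sheetTranslate h p))
    simp [sheetTranslate, mul_assoc]

instance : ContinuousConstSMul (FreeGroup (ArcPair τ)) (TreeCover τ) where
  continuous_const_smul g := isQuotientMap_quot_mk.continuous_iff.2
    (continuous_quot_mk.comp (continuous_sheetTranslate g))

/-- The projection of the tree of discs to the glued disc. -/
def treeProj (hτ : ∀ i, τ (τ i) = i) : TreeCover τ → GluedDisc τ :=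
  Quot.map (fun p => p.2) fun _ _ h => h.arcGluing hτ

lemma continuous_sheet_snd : Continuous fun p : Sheets τ => p.2 :=
  continuous_sigma fun _ => continuous_id

lemma isQuotientMap_treeProj (hτ : ∀ i, τ (τ i) = i) : IsQuotientMap (treeProj hτ) := by
  have hc : Continuous (treeProj hτ) := isQuotientMap_quot_mk.continuous_iff.2
    (continuous_quot_mk.comp continuous_sheet_snd)
  let s : discWithArcs m → Sheets τ := fun a => ⟨1, a⟩
  have hs : Continuous s := continuous_sheetMk 1
  refine IsQuotientMap.of_comp (f := fun a => (Quot.mk _ (s a) : TreeCover τ))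
    (continuous_quot_mk.comp hs) hc ?_
  exact isQuotientMap_quot_mk

lemma treeProj_eq_iff (hτ : ∀ i, τ (τ i) = i) (hτ' : ∀ i, τ i ≠ i) {e e' : TreeCover τ} :
    treeProj hτ e = treeProj hτ e' ↔ e ∈ MulAction.orbit (FreeGroup (ArcPair τ)) e' := by
  constructor
  · obtain ⟨⟨w, a⟩⟩ := e
    obtain ⟨⟨w', a'⟩⟩ := e'
    intro h
    rcases (gluedDisc_mk_eq_iff hτ).1 h with h | h
    · change a = a' at h
      subst h
      refine ⟨w⁻¹ * w', ?_⟩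
      change Quot.mk _ (sheetTranslate _ _) = _
      simp [sheetTranslate]
    · obtain ⟨i, s, h1, h2⟩ := arcGluing_iff.1 h
      change a = _ at h1
      change a' = _ at h2
      subst h1 h2
      obtain ⟨l, rfl⟩ := letterArc_surjective hτ hτ' i
      refine ⟨(letterElt l * w)⁻¹ * w', Eq.symm (Quot.sound ⟨l, s, rfl, ?_, ?_⟩)⟩
      · simp [sheetTranslate, letterArc_letterInv hτ]
      · simp [sheetTranslate]
  · rintro ⟨g, rfl⟩
    obtain ⟨p⟩ := e'
    rfl

/-- It suffices to find a saturated open set of sheet points that contains each point of the disc on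
at most one sheet, because translations change only the sheet. -/
lemma treeCover_exists_nhds (hτ : ∀ i, τ (τ i) = i) (hτ' : ∀ i, τ i ≠ i) (e : TreeCover τ) :
    ∃ U ∈ 𝓝 e, ∀ g : FreeGroup (ArcPair τ), ((g • ·) '' U ∩ U).Nonempty → g = 1 := by
  suffices H : ∃ T : Set (Sheets τ), IsOpen T ∧ (∃ p ∈ T, Quot.mk _ p = e) ∧
      (∀ p q, sheetGluing p q → p ∈ T → q ∈ T) ∧ (∀ p ∈ T, ∀ q ∈ T, p.2 = q.2 → p.1 = q.1) by
    obtain ⟨T, hT, ⟨p, hp, rfl⟩, hsat, hinj⟩ := H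
    have hpre : Quot.mk sheetGluing ⁻¹' (Quot.mk sheetGluing '' T) = T := by
      refine Subset.antisymm ?_ (subset_preimage_image _ _)
      rintro q ⟨p, hp, hpq⟩
      rcases (treeCover_mk_eq_iff hτ).1 hpq with rfl | h
      · exact hp
      · exact hsat _ _ h hp
    refine ⟨Quot.mk _ '' T, IsOpen.mem_nhds ?_ ⟨p, hp, rfl⟩, ?_⟩
    · rw [← isQuotientMap_quot_mk.isOpen_preimage, hpre]
      exact hT
    · rintro g ⟨_, ⟨_, ⟨q, hq, rfl⟩, rfl⟩, hgq⟩
      have : sheetTranslate g q ∈ T := by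
        rw [← hpre]
        exact hgq
      simpa [sheetTranslate] using hinj _ this _ hq rfl
  obtain ⟨⟨w, a⟩⟩ := e
  by_cases ha : ∃ l s, a = arcPoint (letterArc (τ := τ) l) s
  · obtain ⟨l, s, rfl⟩ := ha
    have key : ∀ (l : ArcPair τ × Bool) (s : I) (i : Fin m),
        arcPoint (letterArc l) s ∈ arcStrip i → i = letterArc l := fun l s i h =>
      eq_of_mem_arcStrip h (arcPoint_mem_arcStrip _ _)
    -- Near an arc the set is a strip on each of the two adjacent sheets. Each strip meets only its
    -- own arc, which gives saturation, and the two strips lie over disjoint parts of the disc.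
    refine ⟨{p | (p.1 = w ∧ p.2 ∈ arcStrip (letterArc l)) ∨
      (p.1 = letterElt l * w ∧ p.2 ∈ arcStrip (letterArc (letterInv l)))}, ?_,
      ⟨_, Or.inl ⟨rfl, arcPoint_mem_arcStrip _ _⟩, rfl⟩, ?_, ?_⟩
    · rw [isOpen_sigma_iff]
      intro w'
      change IsOpen {b | (w' = w ∧ b ∈ arcStrip (letterArc l)) ∨
        (w' = letterElt l * w ∧ b ∈ arcStrip (letterArc (letterInv l)))}
      exact (isOpen_const.inter (isOpen_arcStrip _)).union
        (isOpen_const.inter (isOpen_arcStrip _))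
    · rintro ⟨w₁, _⟩ ⟨w₂, _⟩ ⟨l', s', h1, h2, h3⟩ (⟨h4, h5⟩ | ⟨h4, h5⟩)
      · dsimp only at h1 h2 h3 h4 h5
        subst h1 h2 h3 h4
        have := letterArc_injective hτ (key _ _ _ h5)
        subst this
        exact Or.inr ⟨rfl, arcPoint_mem_arcStrip _ _⟩
      · dsimp only at h1 h2 h3 h4 h5
        subst h1 h2 h3 h4
        have := letterArc_injective hτ (key _ _ _ h5)
        subst this
        refine Or.inl ⟨?_, ?_⟩
        · dsimp only
          rw [letterElt_letterInv]; group
        · simpa using arcPoint_mem_arcStrip _ _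
    · have hne : letterArc l ≠ letterArc (letterInv l) := by
        rw [letterArc_letterInv hτ]
        exact (hτ' _).symm
      rintro ⟨w₁, b⟩ (⟨h1, h2⟩ | ⟨h1, h2⟩) ⟨w₂, c⟩ (⟨h3, h4⟩ | ⟨h3, h4⟩) h5 <;>
        dsimp only at h1 h2 h3 h4 h5 ⊢ <;> subst h5
      · rw [h1, h3]
      · exact absurd (eq_of_mem_arcStrip h2 h4) hne
      · exact absurd (eq_of_mem_arcStrip h4 h2) hne
      · rw [h1, h3]
  · refine ⟨{p | p.1 = w ∧ p.2 ∈ (⋃ i : Fin m, range (arcPoint i))ᶜ}, ?_, ⟨⟨w, a⟩, ⟨rfl, ?_⟩, rfl⟩,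
      ?_, ?_⟩
    · rw [isOpen_sigma_iff]
      intro w'
      change IsOpen {b | w' = w ∧ b ∈ (⋃ i : Fin m, range (arcPoint i))ᶜ}
      exact isOpen_const.inter (isClosed_iUnion_of_finite fun i =>
        (isCompact_range (continuous_arcPoint i)).isClosed).isOpen_compl
    · intro h
      obtain ⟨i, s, rfl⟩ := mem_iUnion.1 h
      obtain ⟨l, rfl⟩ := letterArc_surjective hτ hτ' i
      exact ha ⟨l, s, rfl⟩
    · rintro p q ⟨l', s', h1, -, -⟩ ⟨-, h⟩
      exact absurd (mem_iUnion.2 ⟨letterArc l', mem_range.2 ⟨s', h1.symm⟩⟩) h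
    · intro p hp q hq _
      exact hp.1.trans hq.1.symm

lemma isQuotientCoveringMap_treeProj (hτ : ∀ i, τ (τ i) = i) (hτ' : ∀ i, τ i ≠ i) :
    IsQuotientCoveringMap (treeProj hτ) (FreeGroup (ArcPair τ)) where
  toIsQuotientMap := isQuotientMap_treeProj hτ
  continuous_const_smul := continuous_const_smul
  apply_eq_iff_mem_orbit := treeProj_eq_iff hτ hτ'
  disjoint := treeCover_exists_nhds hτ hτ'

end TreeCover

/-! ## The tree of discs is contractible -/

section Contraction

variable {m : ℕ}

lemma convex_discWithArcs : Convex ℝ (discWithArcs m) :=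
  (convex_Icc _ _).prod (convex_Icc _ _)

/-- The point dividing the segment from `a` to `b` in the ratio `s : 1 - s`. -/
def discSegment (a b : discWithArcs m) (s : I) : discWithArcs m :=
  ⟨(1 - (s : ℝ)) • (a : ℝ × ℝ) + (s : ℝ) • (b : ℝ × ℝ),
    convex_discWithArcs a.2 b.2 (by linarith [s.2.2]) s.2.1 (by ring)⟩

lemma continuous_discSegment {X : Type*} [TopologicalSpace X] {f g : X → discWithArcs m}
    {c : X → I} (hf : Continuous f) (hg : Continuous g) (hc : Continuous c) :
    Continuous fun x => discSegment (f x) (g x) (c x) := by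
  unfold discSegment
  fun_prop

@[simp] lemma discSegment_zero (a b : discWithArcs m) : discSegment a b 0 = a :=
  Subtype.ext (by simp [discSegment])

@[simp] lemma discSegment_one (a b : discWithArcs m) : discSegment a b 1 = b :=
  Subtype.ext (by simp [discSegment])

@[simp] lemma discSegment_self (a : discWithArcs m) (s : I) : discSegment a a s = a :=
  Subtype.ext (by simp only [discSegment]; rw [← add_smul]; simp)

/-- The parameter of the projection of a point to the `i`-th arc. -/
def arcCoord (i : Fin m) (a : discWithArcs m) : I :=
  projIcc 0 1 zero_le_one (a.1.1 - (2 * ((i : ℕ) : ℝ) + 1))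

lemma continuous_arcCoord (i : Fin m) : Continuous (arcCoord i) := by
  unfold arcCoord
  exact continuous_projIcc.comp (by fun_prop)

@[simp] lemma arcCoord_arcPoint (i : Fin m) (s : I) : arcCoord i (arcPoint i s) = s := by
  simp [arcCoord]

variable {τ : Fin m → Fin m}

/-- A function of time which is `0` until `1 / (n + 2)` and `1` from `1 / (n + 1)` on. -/
def stageTime (n : ℕ) (s : I) : I :=
  projIcc 0 1 zero_le_one (((n : ℝ) + 1) * (n + 2) * s - (n + 1))

lemma continuous_stageTime (n : ℕ) : Continuous (stageTime n) := by
  unfold stageTime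
  exact continuous_projIcc.comp (by fun_prop)

lemma stageTime_eq_zero {n : ℕ} {s : I} (h : ((n : ℝ) + 2) * s ≤ 1) : stageTime n s = 0 :=
  projIcc_of_le_left _ (by nlinarith [n.cast_nonneg (α := ℝ)])

lemma stageTime_eq_one {n : ℕ} {s : I} (h : 1 ≤ ((n : ℝ) + 1) * s) : stageTime n s = 1 :=
  projIcc_of_right_le _ (by nlinarith [n.cast_nonneg (α := ℝ)])

/-- The contraction of the tree of discs: the discs at distance `n` from the root are collapsed
during the time interval `[1 / (n + 2), 1 / (n + 1)]` to the arc towards the root. -/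
def treeContraction (a₀ : discWithArcs m) :
    List (ArcPair τ × Bool) → discWithArcs m × I → TreeCover τ
  | [], p => Quot.mk _ ⟨1, discSegment p.1 a₀ (stageTime 0 p.2)⟩
  | l :: L, p =>
    if (((l :: L).length : ℝ) + 1) * p.2 ≤ 1 then
      Quot.mk _ ⟨FreeGroup.mk (l :: L), discSegment p.1
        (arcPoint (letterArc (letterInv l)) (arcCoord (letterArc (letterInv l)) p.1))
        (stageTime (l :: L).length p.2)⟩
    else treeContraction a₀ L
      (arcPoint (letterArc l) (σ (arcCoord (letterArc (letterInv l)) p.1)), p.2)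

variable (a₀ : discWithArcs m)

lemma treeContraction_of_le (L : List (ArcPair τ × Bool)) (a : discWithArcs m) {s : I}
    (h : ((L.length : ℝ) + 2) * s ≤ 1) :
    treeContraction a₀ L (a, s) = Quot.mk _ ⟨FreeGroup.mk L, a⟩ := by
  cases L with
  | nil =>
    rw [treeContraction, stageTime_eq_zero (by simpa using h), discSegment_zero]
    rfl
  | cons l L =>
    have hs := s.2.1
    rw [treeContraction, if_pos (by dsimp only; nlinarith), stageTime_eq_zero h, discSegment_zero]

lemma treeCover_mk_cons (l : ArcPair τ × Bool) (L : List (ArcPair τ × Bool)) (s : I) :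
    (Quot.mk _ ⟨FreeGroup.mk (l :: L), arcPoint (letterArc (letterInv l)) s⟩ : TreeCover τ) =
      Quot.mk _ ⟨FreeGroup.mk L, arcPoint (letterArc l) (σ s)⟩ :=
  (Quot.sound ⟨l, σ s, rfl, by simp, (letterElt_mul_mk l L).symm⟩).symm

lemma continuous_treeCover_mk (w : FreeGroup (ArcPair τ)) :
    Continuous fun a : discWithArcs m => (Quot.mk _ ⟨w, a⟩ : TreeCover τ) :=
  continuous_quot_mk.comp (continuous_sheetMk w)

/-- At the switching time the disc has just reached the arc towards the root, while the parent disc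
has not started to move; so both formulas give the same glued point. -/
lemma continuous_treeContraction (L : List (ArcPair τ × Bool)) :
    Continuous (treeContraction a₀ L) := by
  induction L with
  | nil =>
    simp only [treeContraction]
    exact (continuous_treeCover_mk 1).comp (continuous_discSegment continuous_fst continuous_const
      ((continuous_stageTime 0).comp continuous_snd))
  | cons l L ih =>
    simp only [treeContraction]
    have hproj : Continuous fun p : discWithArcs m × I =>
        arcCoord (letterArc (letterInv l)) p.1 := (continuous_arcCoord _).comp continuous_fst
    refine Continuous.if_le ?_ ?_ (by fun_prop) continuous_const ?_
    · exact (continuous_treeCover_mk _).comp (continuous_discSegment continuous_fst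
        ((continuous_arcPoint _).comp hproj) ((continuous_stageTime _).comp continuous_snd))
    · exact ih.comp (((continuous_arcPoint _).comp
        (unitInterval.continuous_symm.comp hproj)).prodMk continuous_snd)
    · rintro ⟨a, s⟩ h
      dsimp only at h ⊢
      rw [stageTime_eq_one h.ge, discSegment_one, treeCover_mk_cons, treeContraction_of_le]
      rw [List.length_cons] at h
      push_cast at h
      linarith

/-- Points already on the arc towards the root wait until the parent disc moves. This makes the
contraction compatible with the gluing of a disc to its parent. -/
lemma treeContraction_cons_arcPoint (l : ArcPair τ × Bool) (L : List (ArcPair τ × Bool))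
    (t s : I) :
    treeContraction a₀ (l :: L) (arcPoint (letterArc (letterInv l)) t, s) =
      treeContraction a₀ L (arcPoint (letterArc l) (σ t), s) := by
  rw [treeContraction]
  simp only [arcCoord_arcPoint, discSegment_self]
  split_ifs with h
  · rw [treeCover_mk_cons, treeContraction_of_le]
    rw [List.length_cons] at h
    push_cast at h
    linarith
  · rfl

lemma treeContraction_one (L : List (ArcPair τ × Bool)) (a : discWithArcs m) :
    treeContraction a₀ L (a, 1) = Quot.mk _ ⟨1, a₀⟩ := by
  induction L generalizing a with
  | nil => rw [treeContraction, stageTime_eq_one (by simp), discSegment_one]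
  | cons l L ih =>
    rw [treeContraction, if_neg, ih]
    simp only [List.length_cons, Icc.coe_one]
    push_cast
    linarith [L.length.cast_nonneg (α := ℝ)]

/-- The tree structure: of two adjacent sheets, one is the parent of the other. -/
lemma toWord_letterElt_mul (l : ArcPair τ × Bool) (w : FreeGroup (ArcPair τ)) :
    (letterElt l * w).toWord = l :: w.toWord ∨
      w.toWord = letterInv l :: (letterElt l * w).toWord := by
  have h : (letterElt l * w).toWord = FreeGroup.reduce (l :: w.toWord) := by
    conv_lhs => rw [← FreeGroup.mk_toWord (x := w), letterElt_mul_mk, FreeGroup.toWord_mk]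
  rw [h, FreeGroup.reduce.cons, FreeGroup.reduce_toWord]
  rcases hw : w.toWord with _ | ⟨l', L⟩
  · exact Or.inl rfl
  · dsimp only
    split_ifs with hl
    · right
      congr 1
      rcases l with ⟨i, b⟩
      rcases l' with ⟨i', b'⟩
      obtain ⟨rfl, hb⟩ := hl
      dsimp only at hb
      simp [letterInv, hb]
    · exact Or.inl rfl

lemma treeContraction_eq_of_sheetGluing {p q : Sheets τ} (h : sheetGluing p q) (s : I) :
    treeContraction a₀ p.1.toWord (p.2, s) = treeContraction a₀ q.1.toWord (q.2, s) := by
  obtain ⟨w, a⟩ := p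
  obtain ⟨w', a'⟩ := q
  obtain ⟨l, t, h1, h2, h3⟩ := h
  dsimp only at h1 h2 h3 ⊢
  subst h1 h2 h3
  rcases toWord_letterElt_mul l w with h | h
  · rw [h, treeContraction_cons_arcPoint, unitInterval.symm_symm]
  · have := treeContraction_cons_arcPoint a₀ (letterInv l) (letterElt l * w).toWord t s
    rw [← h, letterInv_letterInv] at this
    exact this

theorem contractibleSpace_treeCover (τ : Fin m → Fin m) : ContractibleSpace (TreeCover τ) := by
  let a₀ : discWithArcs m := ⟨(0, 0), by
    simp only [discWithArcs, mem_prod, mem_Icc]; refine ⟨⟨le_rfl, by positivity⟩, by norm_num⟩⟩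
  -- Currying lets the homotopy descend through the quotient map without taking the product of that
  -- map with `I`. Continuity is then checked sheet by sheet, where only finitely many stages occur.
  let F : Sheets τ → C(I, TreeCover τ) := fun p =>
    ⟨fun s => treeContraction a₀ p.1.toWord (p.2, s),
      (continuous_treeContraction a₀ _).comp (by fun_prop)⟩
  have hF : Continuous F := continuous_sigma fun w =>
    (ContinuousMap.curry ⟨_, continuous_treeContraction a₀ w.toWord⟩).continuous
  let G : C(TreeCover τ, C(I, TreeCover τ)) :=
    ⟨Quot.lift F fun p q h => ContinuousMap.ext (treeContraction_eq_of_sheetGluing a₀ h),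
      isQuotientMap_quot_mk.continuous_iff.2 hF⟩
  refine (contractible_iff_id_nullhomotopic _).2 ⟨Quot.mk _ ⟨1, a₀⟩, ⟨⟨⟨fun p => G p.2 p.1,
    (ContinuousMap.continuous_uncurry_of_continuous G).comp continuous_swap⟩, ?_, ?_⟩⟩⟩
  · rintro ⟨⟨w, a⟩⟩
    change treeContraction a₀ w.toWord (a, 0) = _
    rw [treeContraction_of_le _ _ _ (by simp), FreeGroup.mk_toWord]
    rfl
  · rintro ⟨⟨w, a⟩⟩
    exact treeContraction_one a₀ _ _

end Contraction

/-- A punctured surface is compact and Hausdorff, and it has a contractible covering by the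
quotient of a group action. -/
theorem IsPuncturedSurface.exists_contractible_covering {S : Type*} [TopologicalSpace S]
    (hS : IsPuncturedSurface S) :
    CompactSpace S ∧ T2Space S ∧ ∃ (G : Type) (_ : Group G) (E : Type) (_ : TopologicalSpace E)
      (_ : MulAction G E) (p : E → S), ContractibleSpace E ∧ IsQuotientCoveringMap p G := by
  obtain ⟨m, τ, hτ, hτ', ⟨f⟩⟩ := hS
  have := gluedDisc_t2Space hτ hτ'
  exact ⟨f.symm.compactSpace, f.symm.t2Space, FreeGroup (ArcPair τ), inferInstance, TreeCover τ,
    inferInstance, inferInstance, f.symm ∘ treeProj hτ, contractibleSpace_treeCover τ,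
    (isQuotientCoveringMap_treeProj hτ hτ').homeomorph_comp f.symm⟩

/-! ## Foliations given by a developing map -/

/-- `Q : E × ℝ → N` is a local homeomorphism whose deck transformations preserve the product
foliation; the ones preserving the leaf at some height are given by an action of `G`, which acts on
the heights by `h`. -/
structure IsFoliatedCover {N E : Type*} [TopologicalSpace N] [TopologicalSpace E] (G : Type*)
    [Group G] [MulAction G E] (Q : E × ℝ → N) (h : G → ℝ → ℝ) : Prop where
  surjective : Function.Surjective Q
  isLocalHomeomorph : IsLocalHomeomorph Q
  deck : ∀ e e' t t', Q (e, t) = Q (e', t') → ∃ (f : E → E) (k : ℝ → ℝ), Continuous f ∧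
    Function.Injective f ∧ Continuous k ∧ (∀ a s, Q (f a, k s) = Q (a, s)) ∧ f e = e' ∧ k t = t'
  one_height : ∀ t, h 1 t = t
  mul_height : ∀ g g' t, h (g * g') t = h g (h g' t)
  map_smul : ∀ g e t, Q (g • e, h g t) = Q (e, t)
  exists_smul : ∀ e e' t, Q (e, t) = Q (e', t) → ∃ g : G, g • e = e' ∧ h g t = t
  generic : ∀ g t, (∀ᶠ s in 𝓝 t, h g s = s) → g = 1

namespace IsFoliatedCover

variable {N E G : Type*} [TopologicalSpace N] [TopologicalSpace E] [Group G] [MulAction G E]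
  {Q : E × ℝ → N} {h : G → ℝ → ℝ}

/-- The foliated charts given by local inverses of `Q` and charts of `E`. -/
def chartSet (Q : E × ℝ → N) (𝒞 : Set (OpenPartialHomeomorph E (EuclideanHalfSpace 2))) :
    Set (OpenPartialHomeomorph N HalfSpaceProd) :=
  {e | ∃ Φ : OpenPartialHomeomorph (E × ℝ) N, EqOn Φ Q Φ.source ∧ ∃ C ∈ 𝒞,
    e = Φ.symm.trans (C.prod (OpenPartialHomeomorph.refl ℝ))}

variable {𝒞 : Set (OpenPartialHomeomorph E (EuclideanHalfSpace 2))}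

lemma exists_chart (hQ : IsFoliatedCover G Q h) (h𝒞 : ∀ e, ∃ C ∈ 𝒞, e ∈ C.source) (e : E) (t : ℝ) :
    ∃ (Φ : OpenPartialHomeomorph (E × ℝ) N) (C : OpenPartialHomeomorph E (EuclideanHalfSpace 2)),
      EqOn Φ Q Φ.source ∧ C ∈ 𝒞 ∧ (e, t) ∈ Φ.source ∧ e ∈ C.source := by
  obtain ⟨Φ, hΦ, hΦ'⟩ := hQ.isLocalHomeomorph (e, t)
  obtain ⟨C, hC, heC⟩ := h𝒞 e
  exact ⟨Φ, C, fun z _ => congrFun hΦ'.symm z, hC, hΦ, heC⟩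

lemma chart_apply {Φ : OpenPartialHomeomorph (E × ℝ) N} (hΦ : EqOn Φ Q Φ.source)
    (C : OpenPartialHomeomorph E (EuclideanHalfSpace 2)) {z : E × ℝ} (hz : z ∈ Φ.source) :
    (Φ.symm.trans (C.prod (OpenPartialHomeomorph.refl ℝ))) (Q z) = (C z.1, z.2) := by
  rw [← hΦ hz]
  simp [Φ.left_inv hz]

lemma mem_chart_source {Φ : OpenPartialHomeomorph (E × ℝ) N} (hΦ : EqOn Φ Q Φ.source)
    {C : OpenPartialHomeomorph E (EuclideanHalfSpace 2)} {y : N} :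
    y ∈ (Φ.symm.trans (C.prod (OpenPartialHomeomorph.refl ℝ))).source ↔
      ∃ z ∈ Φ.source, z.1 ∈ C.source ∧ Q z = y := by
  constructor
  · intro hy
    simp only [OpenPartialHomeomorph.trans_source, OpenPartialHomeomorph.symm_source,
      OpenPartialHomeomorph.prod_source, OpenPartialHomeomorph.refl_source, mem_inter_iff,
      mem_preimage, mem_prod] at hy
    refine ⟨Φ.symm y, Φ.map_target hy.1, hy.2.1, ?_⟩
    rw [← hΦ (Φ.map_target hy.1), Φ.right_inv hy.1]
  · rintro ⟨z, hz, hz', rfl⟩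
    rw [← hΦ hz]
    simp [Φ.map_source hz, Φ.left_inv hz, hz']

lemma continuous (hQ : IsFoliatedCover G Q h) : Continuous Q := hQ.isLocalHomeomorph.continuous

/-- The foliation of `N` whose lift to `E × ℝ` is the product foliation. -/
def foliation (hQ : IsFoliatedCover G Q h) (h𝒞 : ∀ e, ∃ C ∈ 𝒞, e ∈ C.source) :
    SurfaceFoliation N where
  charts := chartSet Q 𝒞
  cover x := by
    obtain ⟨⟨e, t⟩, rfl⟩ := hQ.surjective x
    obtain ⟨Φ, C, hΦ, hC, h1, h2⟩ := hQ.exists_chart h𝒞 e t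
    exact ⟨_, ⟨Φ, hΦ, C, hC, rfl⟩, (mem_chart_source hΦ).2 ⟨_, h1, h2, rfl⟩⟩
  compatible := by
    rintro _ ⟨Φ, hΦ, C, -, rfl⟩ _ ⟨Φ', hΦ', C', -, rfl⟩ x ⟨hx, hx'⟩
    obtain ⟨⟨e, t⟩, hz, -, rfl⟩ := (mem_chart_source hΦ).1 hx
    obtain ⟨⟨e', t'⟩, hz', -, hQz⟩ := (mem_chart_source hΦ').1 hx'
    obtain ⟨f, k, hf, -, hk, hfk, rfl, rfl⟩ := hQ.deck e e' t t' hQz.symm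
    refine ⟨k, ?_⟩
    have h1 : {z : E × ℝ | z ∈ Φ.source ∧ (f z.1, k z.2) ∈ Φ'.source} ∈ 𝓝 (e, t) :=
      Filter.inter_mem (Φ.open_source.mem_nhds hz)
        ((Φ'.open_source.preimage (by fun_prop : Continuous fun z : E × ℝ => (f z.1, k z.2))).mem_nhds
          hz')
    have h2 := hQ.isLocalHomeomorph.isOpenMap.image_mem_nhds h1
    filter_upwards [h2]
    rintro _ ⟨⟨a, s⟩, ⟨ha, ha'⟩, rfl⟩
    rw [chart_apply hΦ C ha, ← hfk a s, chart_apply hΦ' C' ha']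

variable (hQ : IsFoliatedCover G Q h) (h𝒞 : ∀ e, ∃ C ∈ 𝒞, e ∈ C.source)

/-- The parametrization of the leaf at height `t`. -/
def toLeafSpace (t : ℝ) (e : E) : (hQ.foliation h𝒞).LeafSpace := Q (e, t)

/-- In any foliated chart the height along the slice is a function of `t` alone, hence locally
constant; so plaques pull back to open sets. -/
lemma continuous_toLeafSpace (t : ℝ) : Continuous (hQ.toLeafSpace h𝒞 t) := by
  refine continuous_generateFrom_iff.2 ?_
  rintro _ ⟨ch, hch, t', V, hV, rfl⟩
  rw [isOpen_iff_mem_nhds]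
  rintro e ⟨h1, h2, h3⟩
  change Q (e, t) ∈ ch.source at h1
  change (ch (Q (e, t))).2 = t' at h2
  change Q (e, t) ∈ V at h3
  obtain ⟨Φ, C, hΦ, hC, hz, hz'⟩ := hQ.exists_chart h𝒞 e t
  obtain ⟨k, hk⟩ := (hQ.foliation h𝒞).compatible _ ⟨Φ, hΦ, C, hC, rfl⟩ ch hch (Q (e, t))
    ⟨(mem_chart_source hΦ).2 ⟨_, hz, hz', rfl⟩, h1⟩
  have hc : Continuous fun a : E => (a, t) := by fun_prop
  have hQc : Continuous fun a : E => Q (a, t) := hQ.continuous.comp hc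
  have h0 := hk.self_of_nhds
  filter_upwards [hQc.continuousAt.eventually hk, hc.continuousAt.eventually (Φ.open_source.mem_nhds hz),
    hQc.continuousAt.eventually (ch.open_source.mem_nhds h1),
    hQc.continuousAt.eventually (hV.mem_nhds h3)] with a ha1 ha2 ha3 ha4
  refine ⟨ha3, ?_, ha4⟩
  change (ch (Q (a, t))).2 = t'
  rw [← h2, ha1, h0, chart_apply hΦ C ha2, chart_apply hΦ C hz]

lemma isOpenMap_toLeafSpace (t : ℝ) : IsOpenMap (hQ.toLeafSpace h𝒞 t) := by
  intro B hB
  rw [isOpen_iff_mem_nhds]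
  rintro _ ⟨e, he, rfl⟩
  obtain ⟨Φ, C, hΦ, hC, hz, hz'⟩ := hQ.exists_chart h𝒞 e t
  have hopen : IsOpen (Q '' (Φ.source ∩ (B ×ˢ univ))) :=
    hQ.isLocalHomeomorph.isOpenMap _ (Φ.open_source.inter (hB.prod isOpen_univ))
  refine mem_nhds_iff.2 ⟨{y | y ∈ (Φ.symm.trans (C.prod (OpenPartialHomeomorph.refl ℝ))).source ∧
    ((Φ.symm.trans (C.prod (OpenPartialHomeomorph.refl ℝ))) y).2 = t ∧
    y ∈ Q '' (Φ.source ∩ (B ×ˢ univ))}, ?_, ?_, ?_⟩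
  · rintro _ ⟨-, h2, ⟨⟨a, s⟩, ⟨ha1, ha2⟩, rfl⟩⟩
    rw [chart_apply hΦ C ha1] at h2
    dsimp only at h2
    subst h2
    exact ⟨a, ha2.1, rfl⟩
  · exact TopologicalSpace.isOpen_generateFrom_of_mem ⟨_, ⟨Φ, hΦ, C, hC, rfl⟩, t, _, hopen, rfl⟩
  · refine ⟨(mem_chart_source hΦ).2 ⟨_, hz, hz', rfl⟩, ?_, ⟨_, ⟨hz, he, mem_univ _⟩, rfl⟩⟩
    change ((Φ.symm.trans (C.prod (OpenPartialHomeomorph.refl ℝ))) (Q (e, t))).2 = t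
    rw [chart_apply hΦ C hz]

lemma isLeafwise (t : ℝ) {a : I → E} (ha : Continuous a) :
    (hQ.foliation h𝒞).IsLeafwise fun s => Q (a s, t) :=
  (hQ.continuous_toLeafSpace h𝒞 t).comp ha

lemma range_toLeafSpace_eq {e e' : E} {t t' : ℝ} (heq : Q (e, t) = Q (e', t')) :
    range (hQ.toLeafSpace h𝒞 t) ⊆ range (hQ.toLeafSpace h𝒞 t') := by
  obtain ⟨f, k, -, -, -, hfk, -, rfl⟩ := hQ.deck _ _ _ _ heq
  rintro _ ⟨a, rfl⟩
  exact ⟨f a, hfk a t⟩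

/-- Images of slices are open in the leaf topology and, by the deck transformations, either equal or
disjoint. -/
lemma isClopen_range_toLeafSpace (t : ℝ) : IsClopen (range (hQ.toLeafSpace h𝒞 t)) := by
  refine ⟨⟨?_⟩, (hQ.isOpenMap_toLeafSpace h𝒞 t).isOpen_range⟩
  have : (range (hQ.toLeafSpace h𝒞 t))ᶜ =
      ⋃ t' ∈ {t' | Disjoint (range (hQ.toLeafSpace h𝒞 t')) (range (hQ.toLeafSpace h𝒞 t))},
        range (hQ.toLeafSpace h𝒞 t') := by
    ext y
    simp only [mem_compl_iff, mem_iUnion, mem_ofPred_eq, exists_prop]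
    constructor
    · intro hy
      obtain ⟨⟨e, t'⟩, he⟩ := hQ.surjective y
      refine ⟨t', Set.disjoint_left.2 ?_, ⟨e, he⟩⟩
      rintro _ ⟨a, rfl⟩ ⟨b, hb⟩
      exact hy (hQ.range_toLeafSpace_eq h𝒞 (e := a) (e' := b) hb.symm ⟨e, he⟩)
    · rintro ⟨t', hd, hy⟩
      exact Set.disjoint_left.1 hd hy
  rw [this]
  exact isOpen_biUnion fun t' _ => (hQ.isOpenMap_toLeafSpace h𝒞 t').isOpen_range

lemma leaf_eq_range [PathConnectedSpace E] (e : E) (t : ℝ) :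
    (hQ.foliation h𝒞).leaf (Q (e, t)) = range (hQ.toLeafSpace h𝒞 t) := by
  apply Subset.antisymm
  · intro y hy
    let x : (hQ.foliation h𝒞).LeafSpace := Q (e, t)
    obtain ⟨γ⟩ : Joined x y := hy
    have h1 : range γ ⊆ range (hQ.toLeafSpace h𝒞 t) :=
      (isPreconnected_range γ.continuous).subset_isClopen (hQ.isClopen_range_toLeafSpace h𝒞 t)
        ⟨γ 0, mem_range_self _, by rw [γ.source]; exact ⟨e, rfl⟩⟩
    exact h1 ⟨1, γ.target⟩
  · rintro _ ⟨a, rfl⟩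
    exact ⟨(PathConnectedSpace.somePath e a).map (hQ.continuous_toLeafSpace h𝒞 t)⟩

/-- Plaques are open in the leaf topology, so the height is locally constant along the path. -/
lemma eq_of_isLeafwise {a : I → E} {w : I → ℝ} (ha : Continuous a) (hw : Continuous w)
    (hl : (hQ.foliation h𝒞).IsLeafwise fun s => Q (a s, w s)) (s s' : I) : w s = w s' := by
  have hloc : IsLocallyConstant w := by
    rw [IsLocallyConstant.iff_eventually_eq]
    intro s
    obtain ⟨Φ, C, hΦ, hC, hz, hz'⟩ := hQ.exists_chart h𝒞 (a s) (w s)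
    have hopen : IsOpen (X := (hQ.foliation h𝒞).LeafSpace)
        {y | y ∈ (Φ.symm.trans (C.prod (OpenPartialHomeomorph.refl ℝ))).source ∧
        ((Φ.symm.trans (C.prod (OpenPartialHomeomorph.refl ℝ))) y).2 = w s ∧ y ∈ univ} :=
      TopologicalSpace.isOpen_generateFrom_of_mem
        ⟨_, ⟨Φ, hΦ, C, hC, rfl⟩, w s, _, isOpen_univ, rfl⟩
    have h1 := (hopen.preimage hl).mem_nhds (x := s)
      ⟨(mem_chart_source hΦ).2 ⟨_, hz, hz', rfl⟩, by rw [chart_apply hΦ C hz], mem_univ _⟩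
    have hc : Continuous fun s => (a s, w s) := by fun_prop
    filter_upwards [h1, hc.continuousAt.eventually (Φ.open_source.mem_nhds hz)] with r hr hr'
    have h2 := hr.2.1
    rw [chart_apply hΦ C hr'] at h2
    exact h2
  exact hloc.apply_eq_of_isPreconnected isPreconnected_univ (mem_univ s) (mem_univ s')

end IsFoliatedCover

/-! ## Holonomy covers of the leaves -/

namespace IsFoliatedCover

variable {N E G : Type*} [TopologicalSpace N] [TopologicalSpace E] [Group G] [MulAction G E]
  {Q : E × ℝ → N} {h : G → ℝ → ℝ} {𝒞 : Set (OpenPartialHomeomorph E (EuclideanHalfSpace 2))}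

/-- The stabilizer of a height. -/
def heightStabilizer (hQ : IsFoliatedCover G Q h) (t : ℝ) : Subgroup G where
  carrier := {g | h g t = t}
  one_mem' := hQ.one_height t
  mul_mem' {a b} ha hb := by
    change h (a * b) t = t
    rw [hQ.mul_height, show h b t = t from hb, show h a t = t from ha]
  inv_mem' {a} ha := by
    have ha' : h a t = t := ha
    change h a⁻¹ t = t
    conv_lhs => rw [← ha']
    rw [← hQ.mul_height, inv_mul_cancel, hQ.one_height]

variable (hQ : IsFoliatedCover G Q h) (h𝒞 : ∀ e, ∃ C ∈ 𝒞, e ∈ C.source)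

/-- The parametrization of the leaf through `Q (e₀, t)`. -/
def leafProj [PathConnectedSpace E] (e₀ : E) (t : ℝ) (e : E) :
    (hQ.foliation h𝒞).leaf (Q (e₀, t)) :=
  ⟨hQ.toLeafSpace h𝒞 t e, by rw [leaf_eq_range]; exact mem_range_self e⟩

/-- Identifications within one slice come from elements of `G` fixing its height, and these act on
`E` with the disjointness property of `G`. -/
lemma isQuotientCoveringMap_leafProj [PathConnectedSpace E] [ContinuousConstSMul G E]
    (hG : ∀ e : E, ∃ U ∈ 𝓝 e, ∀ g : G, ((g • ·) '' U ∩ U).Nonempty → g = 1) (e₀ : E) (t : ℝ) :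
    IsQuotientCoveringMap (hQ.leafProj h𝒞 e₀ t) (hQ.heightStabilizer t) where
  toIsQuotientMap := by
    refine IsOpenMap.isQuotientMap ?_ ((hQ.continuous_toLeafSpace h𝒞 t).subtype_mk _) ?_
    · intro B hB
      have : hQ.leafProj h𝒞 e₀ t '' B = Subtype.val ⁻¹' (hQ.toLeafSpace h𝒞 t '' B) := by
        ext y
        constructor
        · rintro ⟨b, hb, rfl⟩
          exact ⟨b, hb, rfl⟩
        · rintro ⟨b, hb, hy⟩
          exact ⟨b, hb, Subtype.ext hy⟩
      rw [this]
      exact (hQ.isOpenMap_toLeafSpace h𝒞 t B hB).preimage continuous_subtype_val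
    · rintro ⟨y, hy⟩
      rw [leaf_eq_range] at hy
      obtain ⟨e, rfl⟩ := hy
      exact ⟨e, rfl⟩
  continuous_const_smul g := continuous_const_smul (g : G)
  apply_eq_iff_mem_orbit {e₁ e₂} := by
    constructor
    · intro he
      have he' : Q (e₂, t) = Q (e₁, t) := (congrArg Subtype.val he).symm
      obtain ⟨g, hg, hgt⟩ := hQ.exists_smul _ _ _ he'
      exact ⟨⟨g, hgt⟩, hg⟩
    · rintro ⟨⟨g, hgt⟩, rfl⟩
      refine Subtype.ext ?_
      change Q (g • e₂, t) = Q (e₂, t)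
      have := hQ.map_smul g e₂ t
      rwa [show h g t = t from hgt] at this
  disjoint e := by
    obtain ⟨U, hU, hd⟩ := hG e
    exact ⟨U, hU, fun g hg => Subtype.ext (hd g hg)⟩

section Lifting

variable [PathConnectedSpace E] [ContinuousConstSMul G E]

lemma exists_lift_of_isLeafwise
    (hG : ∀ e : E, ∃ U ∈ 𝓝 e, ∀ g : G, ((g • ·) '' U ∩ U).Nonempty → g = 1)
    {c : I → N} (hc : (hQ.foliation h𝒞).IsLeafwise c) {b : E} {t : ℝ}
    (h0 : c 0 = Q (b, t)) : ∃ L : C(I, E), L 0 = b ∧ ∀ s, Q (L s, t) = c s := by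
  have hmem : ∀ s, c s ∈ (hQ.foliation h𝒞).leaf (Q (b, t)) := by
    intro s
    rw [leaf_eq_range]
    exact (isPreconnected_range hc).subset_isClopen (hQ.isClopen_range_toLeafSpace h𝒞 t)
      ⟨c 0, mem_range_self _, ⟨b, h0.symm⟩⟩ (mem_range_self s)
  obtain ⟨L, hL, hL0⟩ :=
    (hQ.isQuotientCoveringMap_leafProj h𝒞 hG b t).isCoveringMap.exists_path_lifts
      ⟨fun s => ⟨c s, hmem s⟩, hc.subtype_mk _⟩ b (Subtype.ext h0)
  exact ⟨L, hL0, fun s => congrArg Subtype.val (congrFun hL s)⟩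

lemma lift_unique (hQ : IsFoliatedCover G Q h) (h𝒞 : ∀ e, ∃ C ∈ 𝒞, e ∈ C.source)
    (hG : ∀ e : E, ∃ U ∈ 𝓝 e, ∀ g : G, ((g • ·) '' U ∩ U).Nonempty → g = 1)
    {L L' : C(I, E)} {t : ℝ} (heq : ∀ s, Q (L s, t) = Q (L' s, t)) (h0 : L 0 = L' 0) : L = L' := by
  refine DFunLike.coe_injective
    ((hQ.isQuotientCoveringMap_leafProj h𝒞 hG (L 0) t).isCoveringMap.eq_of_comp_eq
      L.continuous L'.continuous ?_ 0 h0)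
  funext s
  exact Subtype.ext (heq s)

/-- A loop that lifts to a closed path can be pushed to nearby heights by keeping its `E`-component.
Conversely, trivial holonomy forces the element `g` joining the ends of a lift to act trivially on
all nearby heights, so `g = 1`. -/
lemma hasTrivialHolonomy_iff [T2Space E]
    (hG : ∀ e : E, ∃ U ∈ 𝓝 e, ∀ g : G, ((g • ·) '' U ∩ U).Nonempty → g = 1)
    (t : ℝ) (L : C(I, E)) (hL : Q (L 0, t) = Q (L 1, t)) :
    L 0 = L 1 ↔ (hQ.foliation h𝒞).HasTrivialHolonomy fun s => Q (L s, t) := by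
  constructor
  · intro h01
    obtain ⟨Φ, C, hΦ, hC, hz, hz'⟩ := hQ.exists_chart h𝒞 (L 0) t
    set ch := Φ.symm.trans (C.prod (OpenPartialHomeomorph.refl ℝ)) with hch
    have h1 : ch (Q (L 0, t)) = (C (L 0), t) := chart_apply hΦ C hz
    have hsrc : Q (L 0, t) ∈ ch.source := (mem_chart_source hΦ).2 ⟨_, hz, hz', rfl⟩
    refine ⟨ch, ⟨Φ, hΦ, C, hC, rfl⟩, hsrc, ?_⟩
    have h2 : (C (L 0), t) ∈ ch.target := h1 ▸ ch.map_source hsrc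
    have hc : Continuous fun t' : ℝ => (C (L 0), t') := by fun_prop
    obtain ⟨δ, hδ, hball⟩ := Metric.mem_nhds_iff.1
      (hc.continuousAt.preimage_mem_nhds (ch.open_target.mem_nhds h2))
    have hδ' : ∀ t' ∈ Metric.ball t δ, (C (L 0), t') ∈ ch.target ∧
        Q (L 0, t') = ch.symm (C (L 0), t') := by
      intro t' ht'
      have h3 : (C (L 0), t') ∈ ch.target := hball ht'
      refine ⟨h3, ?_⟩
      have h4 : (C.symm (C (L 0)), t') ∈ Φ.source := h3.2
      rw [C.left_inv hz'] at h4
      change _ = Φ (C.symm (C (L 0)), t')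
      rw [C.left_inv hz', hΦ h4]
    refine ⟨δ, hδ, fun z => Q (L z.1, z.2), ?_, ?_, ?_⟩
    · exact (hQ.continuous.comp (by fun_prop)).continuousOn
    · intro s
      dsimp only
      rw [h1]
    · intro t' ht'
      dsimp only at ht' ⊢
      rw [← h01, h1] at *
      exact ⟨hQ.isLeafwise h𝒞 t' L.continuous, hδ' t' ht', hδ' t' ht'⟩
  · rintro ⟨_, ⟨Φ, hΦ, C, -, rfl⟩, hsrc, δ, hδ, H, hHc, hHt, hH⟩
    obtain ⟨⟨b, t₁⟩, hz, hz', hbt⟩ := (mem_chart_source hΦ).1 hsrc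
    set ch := Φ.symm.trans (C.prod (OpenPartialHomeomorph.refl ℝ)) with hch
    have h1 : ch (Q (b, t₁)) = (C b, t₁) := chart_apply hΦ C hz
    dsimp only at hz' hbt hHc hHt hH
    rw [← hL, ← hbt, h1] at hH
    rw [← hbt, h1] at hHc hHt
    dsimp only [id] at hHc hHt hH
    have hsymm : ∀ t', (C b, t') ∈ ch.target → ch.symm (C b, t') = Q (b, t') := by
      intro t' h3
      have h4 : (C.symm (C b), t') ∈ Φ.source := h3.2
      rw [C.left_inv hz'] at h4
      change Φ (C.symm (C b), t') = _
      rw [C.left_inv hz', hΦ h4]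
    have hl : ∀ t' : Metric.ball t₁ δ, ∃ K : C(I, E), K 0 = b ∧ ∀ s, Q (K s, t') = H (s, t') := by
      rintro ⟨t', ht'⟩
      obtain ⟨h5, ⟨h6, h7⟩, -⟩ := hH t' ht'
      exact hQ.exists_lift_of_isLeafwise h𝒞 hG h5 (h7.trans (hsymm t' h6))
    choose K hK0 hK using hl
    let f : C(I × Metric.ball t₁ δ, N) := ⟨fun z => H (z.1, z.2),
      hHc.comp_continuous (by fun_prop) fun z => ⟨mem_univ _, z.2.2⟩⟩
    -- Lifts chosen separately for each height fit together continuously, since they all start over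
    -- `b` and `Q` is a separated local homeomorphism.
    have hcont : Continuous fun z : I × Metric.ball t₁ δ => (K z.2 z.1, (z.2 : ℝ)) := by
      refine hQ.isLocalHomeomorph.continuous_lift (T2Space.isSeparatedMap Q) f
        (funext fun z => hK z.2 z.1) ?_ fun a => (K a).continuous.prodMk (continuous_const (y := (a : ℝ)))
      simp only [hK0]
      fun_prop
    let t₁' : Metric.ball t₁ δ := ⟨t₁, Metric.mem_ball_self hδ⟩
    have hK1 : ∀ t' : Metric.ball t₁ δ, ∃ g : G, g • b = K t' 1 ∧ h g t' = t' := by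
      intro t'
      apply hQ.exists_smul
      obtain ⟨-, -, h6, h7⟩ := hH t' t'.2
      rw [hK, h7, hsymm _ h6]
    obtain ⟨g, hg, hgt⟩ := hK1 t₁'
    -- The endpoints vary continuously inside one orbit, so the group element is locally constant.
    -- The single `g` thus fixes every height near `t₁`.
    have hg1 : g = 1 := by
      refine hQ.generic g t₁ ?_
      obtain ⟨U, hU, hd⟩ := hG (K t₁' 1)
      have hc1 : Continuous fun t' : Metric.ball t₁ δ => K t' 1 :=
        (continuous_fst.comp hcont).comp (by fun_prop : Continuous fun t' => ((1 : I), t'))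
      have hev : ∀ᶠ t' : Metric.ball t₁ δ in 𝓝 t₁', h g t' = t' := by
        filter_upwards [hc1.continuousAt.preimage_mem_nhds hU] with t' ht'
        obtain ⟨g', hg', hgt'⟩ := hK1 t'
        have : g' * g⁻¹ = 1 := by
          refine hd _ ⟨K t' 1, ⟨K t₁' 1, mem_of_mem_nhds hU, ?_⟩, ht'⟩
          dsimp only
          rw [← hg, ← hg', smul_smul, inv_mul_cancel_right]
        rwa [← mul_inv_eq_one.1 this]
      have hmap := map_nhds_subtype_coe_eq_nhds (Metric.mem_ball_self hδ)
        (Metric.ball_mem_nhds t₁ hδ)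
      rw [← hmap]
      exact hev
    rw [hg1, one_smul] at hg
    -- The chart may see the base point through another lift than `L 0`; a deck transformation
    -- carries `L` to the lift starting at `b`.
    obtain ⟨k, r, hk, hkinj, -, hkr, hk0, rfl⟩ := hQ.deck _ _ _ _ hbt.symm
    have hLK : (⟨fun s => k (L s), by fun_prop⟩ : C(I, E)) = K t₁' := by
      refine hQ.lift_unique h𝒞 hG (t := r t) ?_ (hk0.trans (hK0 _).symm)
      intro s
      change Q (k (L s), r t) = Q (K t₁' s, (t₁' : ℝ))
      rw [hkr, hK, ← hHt s]
    have h1' := DFunLike.congr_fun hLK 1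
    change k (L 1) = K t₁' 1 at h1'
    exact hkinj (hk0.trans (hg.trans h1'.symm))

theorem isHolonomyCover [T2Space E]
    (hG : ∀ e : E, ∃ U ∈ 𝓝 e, ∀ g : G, ((g • ·) '' U ∩ U).Nonempty → g = 1)
    (e₀ : E) (t : ℝ) :
    (hQ.foliation h𝒞).IsHolonomyCover (Q (e₀, t)) (hQ.leafProj h𝒞 e₀ t) where
  isCoveringMap := (hQ.isQuotientCoveringMap_leafProj h𝒞 hG e₀ t).isCoveringMap
  pathConnected := inferInstance
  closed_iff L hL := hQ.hasTrivialHolonomy_iff h𝒞 hG t L (congrArg Subtype.val hL)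

end Lifting

theorem _root_.SurfaceFoliation.IsHolonomyCover.comp_homeomorph {F : SurfaceFoliation N} {x : N}
    {pr : E → F.leaf x} (hpr : F.IsHolonomyCover x pr) {E' : Type*} [TopologicalSpace E']
    (f : E' ≃ₜ E) : F.IsHolonomyCover x (pr ∘ f) where
  isCoveringMap := hpr.isCoveringMap.comp_homeomorph f
  pathConnected := by
    have := hpr.pathConnected
    exact f.symm.surjective.pathConnectedSpace f.symm.continuous
  closed_iff L hL := by
    rw [← f.injective.eq_iff]
    exact hpr.closed_iff ⟨fun s => f (L s), by fun_prop⟩ hL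

theorem isTypical {N : Type u} {E : Type} [TopologicalSpace N] [TopologicalSpace E] [MulAction G E]
    {Q : E × ℝ → N} {𝒞 : Set (OpenPartialHomeomorph E (EuclideanHalfSpace 2))}
    (hQ : IsFoliatedCover G Q h) (h𝒞 : ∀ e, ∃ C ∈ 𝒞, e ∈ C.source)
    [ContractibleSpace E] [T2Space E] [ContinuousConstSMul G E]
    (hG : ∀ e : E, ∃ U ∈ 𝓝 e, ∀ g : G, ((g • ·) '' U ∩ U).Nonempty → g = 1) :
    (hQ.foliation h𝒞).IsTypical := by
  intro x
  obtain ⟨⟨e, t⟩, rfl⟩ := hQ.surjective x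
  -- The definition asks for a cover in the universe of `N`.
  exact ⟨ULift.{u} E, inferInstance, _,
    (hQ.isHolonomyCover h𝒞 hG e t).comp_homeomorph Homeomorph.ulift,
    Homeomorph.ulift.contractibleSpace⟩

end IsFoliatedCover

/-! ## Homeomorphisms of the line supported in the unit interval -/

/-- A strictly increasing continuous function which is the identity outside the unit interval. -/
structure IsUnitMap (u : ℝ → ℝ) : Prop where
  strictMono : StrictMono u
  continuous : Continuous u
  eq_of_le : ∀ t ≤ 0, u t = t
  eq_of_ge : ∀ t, 1 ≤ t → u t = t

/-- The displacement `g t - t` of a self-map of the unit interval, extended by zero. -/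
def displacement (g : I ≃ₜ I) (t : ℝ) : ℝ :=
  (g (projIcc 0 1 zero_le_one t) : ℝ) - projIcc 0 1 zero_le_one t

/-- The extension by the identity of a self-map of the unit interval. -/
def unitExtension (g : I ≃ₜ I) (t : ℝ) : ℝ := t + displacement g t

lemma continuous_displacement (g : I ≃ₜ I) : Continuous (displacement g) := by
  unfold displacement
  have : Continuous (projIcc (0 : ℝ) 1 zero_le_one) := continuous_projIcc
  fun_prop

section

variable {g : I ≃ₜ I}

lemma monotone_homeo_zero (hg : Monotone g) : g 0 = 0 :=
  le_antisymm (by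
    have h := hg (show (0 : I) ≤ g.symm 0 from (g.symm 0).2.1)
    rwa [g.apply_symm_apply] at h) (g 0).2.1

lemma monotone_homeo_one (hg : Monotone g) : g 1 = 1 :=
  le_antisymm (g 1).2.2 (by
    have h := hg (show g.symm 1 ≤ (1 : I) from (g.symm 1).2.2)
    rwa [g.apply_symm_apply] at h)

lemma displacement_of_le (hg : Monotone g) {t : ℝ} (ht : t ≤ 0) : displacement g t = 0 := by
  have h : projIcc (0 : ℝ) 1 zero_le_one t = (0 : I) := projIcc_of_le_left _ ht
  rw [displacement, h, monotone_homeo_zero hg, sub_self]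

lemma displacement_of_ge (hg : Monotone g) {t : ℝ} (ht : 1 ≤ t) : displacement g t = 0 := by
  have h : projIcc (0 : ℝ) 1 zero_le_one t = (1 : I) := projIcc_of_right_le _ ht
  rw [displacement, h, monotone_homeo_one hg, sub_self]

lemma unitExtension_coe (t : I) : unitExtension g t = g t := by
  simp [unitExtension, displacement]

/-- For strict monotonicity, write the map as `g` of the projection of `t` plus the difference of
`t` and its projection. Both terms are monotone; the first is strict when the projection moves, and
otherwise the displacement is unchanged. -/
lemma isUnitMap_unitExtension (hg : Monotone g) : IsUnitMap (unitExtension g) where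
  strictMono := by
    have hs : StrictMono g := hg.strictMono_of_injective g.injective
    intro a b hab
    rcases (monotone_projIcc (zero_le_one (α := ℝ)) hab.le).lt_or_eq with h | h
    · have h1 : ((g (projIcc 0 1 zero_le_one a) : I) : ℝ) < g (projIcc 0 1 zero_le_one b) := hs h
      have h2 : a - (projIcc (0 : ℝ) 1 zero_le_one a : ℝ) ≤
          b - (projIcc (0 : ℝ) 1 zero_le_one b : ℝ) := by
        simp only [coe_projIcc]
        rcases le_total 1 a with h3 | h3 <;> rcases le_total 1 b with h4 | h4 <;>
          rcases le_total 0 a with h5 | h5 <;> rcases le_total 0 b with h6 | h6 <;>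
          simp only [min_eq_left, min_eq_right, max_eq_left, max_eq_right, *, zero_le_one] <;>
          linarith
      simp only [unitExtension, displacement]
      linarith
    · simp only [unitExtension, displacement, h]
      linarith
  continuous := continuous_id.add (continuous_displacement g)
  eq_of_le t ht := by rw [unitExtension, displacement_of_le hg ht, add_zero]
  eq_of_ge t ht := by rw [unitExtension, displacement_of_ge hg ht, add_zero]

end

@[simp] lemma displacement_one (t : ℝ) : displacement 1 t = 0 := by
  simp [displacement]

@[simp] lemma unitExtension_one (t : ℝ) : unitExtension 1 t = t := by
  simp [unitExtension]

lemma unitExtension_mul {g g' : I ≃ₜ I} (hg : Monotone g) (hg' : Monotone g') (t : ℝ) :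
    unitExtension (g * g') t = unitExtension g (unitExtension g' t) := by
  have hgg : Monotone (g * g') := hg.comp hg'
  rcases le_or_gt t 0 with h | h
  · rw [(isUnitMap_unitExtension hgg).eq_of_le t h, (isUnitMap_unitExtension hg').eq_of_le t h,
      (isUnitMap_unitExtension hg).eq_of_le t h]
  rcases le_or_gt 1 t with h' | h'
  · rw [(isUnitMap_unitExtension hgg).eq_of_ge t h', (isUnitMap_unitExtension hg').eq_of_ge t h',
      (isUnitMap_unitExtension hg).eq_of_ge t h']
  lift t to I using ⟨h.le, h'.le⟩
  rw [unitExtension_coe, unitExtension_coe, unitExtension_coe]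
  rfl

namespace IsUnitMap

variable {u : ℝ → ℝ}

lemma nonneg (hu : IsUnitMap u) {t : ℝ} (ht : 0 ≤ t) : 0 ≤ u t := by
  simpa [hu.eq_of_le 0 le_rfl] using hu.strictMono.monotone ht

lemma lt_one (hu : IsUnitMap u) {t : ℝ} (ht : t < 1) : u t < 1 := by
  simpa [hu.eq_of_ge 1 le_rfl] using hu.strictMono ht

lemma sum {ι : Type*} [Fintype ι] {v : ι → ℝ → ℝ} (hv : ∀ i, IsUnitMap (v i)) {a : ι → ℝ}
    (ha : ∀ i, 0 ≤ a i) (ha1 : ∑ i, a i = 1) : IsUnitMap fun t => ∑ i, a i * v i t where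
  strictMono := by
    intro s t hst
    have hpos : ∃ i, 0 < a i := by
      by_contra! hn
      have : ∑ i, a i ≤ 0 := Finset.sum_nonpos fun i _ => hn i
      linarith
    obtain ⟨j, hj⟩ := hpos
    exact Finset.sum_lt_sum
      (fun i _ => mul_le_mul_of_nonneg_left ((hv i).strictMono.monotone hst.le) (ha i))
      ⟨j, Finset.mem_univ j, mul_lt_mul_of_pos_left ((hv j).strictMono hst) hj⟩
  continuous := continuous_finsetSum _ fun i _ => continuous_const.mul (hv i).continuous
  eq_of_le t ht := by
    simp only [fun i => (hv i).eq_of_le t ht]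
    rw [← Finset.sum_mul, ha1, one_mul]
  eq_of_ge t ht := by
    simp only [fun i => (hv i).eq_of_ge t ht]
    rw [← Finset.sum_mul, ha1, one_mul]

end IsUnitMap

/-- The function which on `[n, n + 1]` is the conjugate of `u n` by the translation by `n`. -/
def assemble (u : ℤ → ℝ → ℝ) (t : ℝ) : ℝ := ⌊t⌋ + u ⌊t⌋ (Int.fract t)

section Assemble

variable {u v : ℤ → ℝ → ℝ}

lemma assemble_id (t : ℝ) : assemble (fun _ t => t) t = t := Int.floor_add_fract t

/-- Reindexing the blocks is what later matches the heights under $(x,t+1)\sim(\varphi(x),t)$. -/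
lemma assemble_sub_int (u : ℤ → ℝ → ℝ) (t : ℝ) (m : ℤ) :
    assemble (fun n => u (n + m)) (t - m) = assemble u t - m := by
  simp only [assemble, Int.floor_sub_intCast, Int.fract_sub_intCast, sub_add_cancel]
  push_cast
  ring

lemma floor_assemble (hu : ∀ n, IsUnitMap (u n)) (t : ℝ) : ⌊assemble u t⌋ = ⌊t⌋ := by
  rw [Int.floor_eq_iff, assemble]
  have h1 := (hu ⌊t⌋).nonneg (Int.fract_nonneg t)
  have h2 := (hu ⌊t⌋).lt_one (Int.fract_lt_one t)
  constructor <;> linarith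

lemma assemble_comp (hv : ∀ n, IsUnitMap (v n)) (t : ℝ) :
    assemble (fun n t => u n (v n t)) t = assemble u (assemble v t) := by
  have h : Int.fract (assemble v t) = v ⌊t⌋ (Int.fract t) := by
    rw [Int.fract, floor_assemble hv, assemble]; ring
  conv_rhs => rw [assemble, h, floor_assemble hv]
  rfl

lemma strictMono_assemble (hu : ∀ n, IsUnitMap (u n)) : StrictMono (assemble u) := by
  intro s t hst
  rcases (Int.floor_mono hst.le).lt_or_eq with h | h
  · have h1 := Int.lt_floor_add_one (assemble u s)
    have h2 := Int.floor_le (assemble u t)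
    rw [floor_assemble hu] at h1 h2
    have h3 : ((⌊s⌋ : ℤ) : ℝ) + 1 ≤ ⌊t⌋ := by exact_mod_cast h
    linarith
  · unfold assemble
    rw [h]
    have : Int.fract s < Int.fract t := by
      rw [Int.fract, Int.fract, h]; linarith
    linarith [(hu ⌊t⌋).strictMono this]

/-- On each side of `n` one of the two displacements vanishes. A formula without case distinction
across the integer yields continuity, and later smoothness, at the junction. -/
lemma assemble_eq_on_Ioo (hu : ∀ n, IsUnitMap (u n)) {n : ℤ} {t : ℝ}
    (ht : t ∈ Ioo ((n : ℝ) - 1) (n + 1)) :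
    assemble u t = t + (u n (t - n) - (t - n)) + (u (n - 1) (t - n + 1) - (t - n + 1)) := by
  obtain ⟨h1, h2⟩ := ht
  rcases le_or_gt (n : ℝ) t with h | h
  · have hf : ⌊t⌋ = n := Int.floor_eq_iff.2 ⟨h, h2⟩
    rw [assemble, Int.fract, hf, (hu (n - 1)).eq_of_ge (t - n + 1) (by linarith)]
    ring
  · have hf : ⌊t⌋ = n - 1 := Int.floor_eq_iff.2 ⟨by push_cast; linarith, by push_cast; linarith⟩
    have h3 : t - ((n - 1 : ℤ) : ℝ) = t - n + 1 := by push_cast; ring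
    rw [assemble, Int.fract, hf, (hu n).eq_of_le (t - n) (by linarith), h3]
    push_cast
    ring

lemma assemble_eq_on_Icc (hu : ∀ n, IsUnitMap (u n)) {t : ℝ} (ht : t ∈ Icc (0 : ℝ) 1) :
    assemble u t = u 0 t := by
  rcases ht.2.lt_or_eq with h | rfl
  · rw [assemble_eq_on_Ioo hu (n := 0) ⟨by simpa using by linarith [ht.1], by simpa using h⟩,
      (hu (0 - 1)).eq_of_ge _ (by simpa using ht.1)]
    simp
  · have : ⌊(1 : ℝ)⌋ = 1 := Int.floor_one
    rw [assemble, Int.fract, this, (hu 0).eq_of_ge 1 le_rfl, (hu 1).eq_of_le _ (by simp)]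
    simp

lemma mem_Ioo_floor (t : ℝ) : t ∈ Ioo ((⌊t⌋ : ℝ) - 1) (⌊t⌋ + 1) :=
  ⟨by linarith [Int.floor_le t], Int.lt_floor_add_one t⟩

lemma continuous_assemble (hu : ∀ n, IsUnitMap (u n)) : Continuous (assemble u) := by
  rw [continuous_iff_continuousAt]
  intro t
  have h := Filter.eventually_of_mem (isOpen_Ioo.mem_nhds (mem_Ioo_floor t))
    fun s hs => assemble_eq_on_Ioo hu hs
  refine ContinuousAt.congr ?_ (h.mono fun s hs => hs.symm)
  have h1 := (hu ⌊t⌋).continuous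
  have h2 := (hu (⌊t⌋ - 1)).continuous
  fun_prop

/-- Preserving the integer part keeps `f t` within distance one of `t`, so `f` tends to both
infinities. -/
lemma surjective_of_floor_eq {f : ℝ → ℝ} (hf : Continuous f)
    (hfl : ∀ t, ⌊f t⌋ = ⌊t⌋) : Function.Surjective f := by
  refine hf.surjective ?_ ?_
  · refine tendsto_atTop_mono (fun t => ?_) (tendsto_atTop_add_const_right _ (-1) tendsto_id)
    have h1 := Int.floor_le (f t)
    have h2 := Int.lt_floor_add_one t
    rw [hfl] at h1
    simp only [_root_.id]
    linarith
  · refine tendsto_atBot_mono (fun t => ?_) (tendsto_atBot_add_const_right _ 1 tendsto_id)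
    have h1 := Int.lt_floor_add_one (f t)
    have h2 := Int.floor_le t
    rw [hfl] at h1
    simp only [_root_.id]
    linarith

end Assemble

/-! ## Lifting to a contractible covering -/

section ContractibleCovering

variable {S E G : Type*} [TopologicalSpace S] [TopologicalSpace E] [Group G] [MulAction G E]
  {p : E → S}

/-- The contraction of `E` turns `f` into the end of a homotopy from a constant map, which lifts
trivially; homotopy lifting does the rest. -/
lemma IsCoveringMap.exists_lift_of_contractible [ContractibleSpace E] (hp : IsCoveringMap p)
    (hsurj : Function.Surjective p) {f : E → S} (hf : Continuous f) :
    ∃ F : E → E, Continuous F ∧ ∀ e, p (F e) = f e := by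
  obtain ⟨c, ⟨H⟩⟩ := id_nullhomotopic E
  obtain ⟨e₁, he₁⟩ := hsurj (f c)
  let K : C(I × E, S) := ⟨fun z => f (H (σ z.1, z.2)), by fun_prop⟩
  have hK : ∀ a, K (0, a) = p (ContinuousMap.const E e₁ a) := by
    intro a
    change f (H (σ 0, a)) = p e₁
    rw [unitInterval.symm_zero, H.apply_one, he₁]
    rfl
  refine ⟨fun e => hp.liftHomotopy K (ContinuousMap.const E e₁) hK (1, e), by fun_prop, ?_⟩
  intro e
  have h1 := congrFun (hp.liftHomotopy_lifts K (ContinuousMap.const E e₁) hK) (1, e)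
  refine h1.trans ?_
  change f (H (σ 1, e)) = f e
  rw [unitInterval.symm_one, H.apply_zero]
  rfl

namespace IsQuotientCoveringMap

lemma eq_of_smul_eq_smul (hp : IsQuotientCoveringMap p G) {g g' : G} {e : E}
    (h : g • e = g' • e) : g = g' :=
  hp.isCancelSMul.right_cancel _ _ _ h

lemma exists_smul_eq (hp : IsQuotientCoveringMap p G) {e e' : E} (h : p e = p e') :
    ∃ g : G, g • e = e' :=
  hp.apply_eq_iff_mem_orbit.1 h.symm

/-- Both sides lift the same map, so agreement at one point suffices. -/
lemma exists_equivariance [PreconnectedSpace E] [Nonempty E] (hp : IsQuotientCoveringMap p G)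
    {ψ : E → E} (hψ : Continuous ψ) {χ : S → S} (h : ∀ e, p (ψ e) = χ (p e)) :
    ∃ c : G → G, ∀ g e, ψ (g • e) = c g • ψ e := by
  have := hp.toContinuousConstSMul
  have e₀ : E := Classical.arbitrary E
  choose c hc using fun g : G => hp.exists_smul_eq (e := ψ e₀) (e' := ψ (g • e₀))
    (by rw [h, h, hp.map_smul])
  refine ⟨c, fun g e => ?_⟩
  refine congrFun (hp.isCoveringMap.eq_of_comp_eq (g₁ := fun e => ψ (g • e))
    (g₂ := fun e => c g • ψ e) (by fun_prop) (by fun_prop) ?_ e₀ (hc g).symm) e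
  funext e
  simp only [Function.comp_apply, h, hp.map_smul]

/-- Lifts of `φ` and of its inverse compose to lifts of the identity, that is, to elements of `G`,
which correct the inverse. -/
theorem exists_homeomorph_lift [ContractibleSpace E] (hp : IsQuotientCoveringMap p G)
    (φ : S ≃ₜ S) : ∃ ψ : E ≃ₜ E, ∀ e, p (ψ e) = φ (p e) := by
  have := hp.toContinuousConstSMul
  have hpc := hp.isCoveringMap.continuous
  obtain ⟨F, hF, hpF⟩ := hp.isCoveringMap.exists_lift_of_contractible hp.surjective
    (f := fun e => φ (p e)) (by fun_prop)
  obtain ⟨F', hF', hpF'⟩ := hp.isCoveringMap.exists_lift_of_contractible hp.surjective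
    (f := fun e => φ.symm (p e)) (by fun_prop)
  have e₀ : E := Classical.arbitrary E
  have key : ∀ A : E → E, Continuous A → (∀ e, p (A e) = p e) → ∃ g : G, ∀ e, A e = g • e := by
    intro A hA hpA
    obtain ⟨g, hg⟩ := hp.exists_smul_eq (hpA e₀).symm
    refine ⟨g, fun e => congrFun (hp.isCoveringMap.eq_of_comp_eq (g₁ := A)
      (g₂ := fun e => g • e) hA (by fun_prop) ?_ e₀ hg.symm) e⟩
    funext e
    simp only [Function.comp_apply, hpA, hp.map_smul]
  obtain ⟨g, hg⟩ := key (F' ∘ F) (hF'.comp hF) fun e => by simp [hpF, hpF']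
  obtain ⟨g', hg'⟩ := key (F ∘ F') (hF.comp hF') fun e => by simp [hpF, hpF']
  have hleft : ∀ e, g⁻¹ • F' (F e) = e := fun e => by
    rw [show F' (F e) = g • e from hg e, inv_smul_smul]
  refine ⟨⟨⟨F, fun e => g⁻¹ • F' e, hleft, fun e => ?_⟩, hF, by fun_prop⟩, hpF⟩
  have : e = F (F' (g'⁻¹ • e)) := by
    rw [show F (F' (g'⁻¹ • e)) = _ from hg' _, smul_inv_smul]
  rw [this]
  dsimp only
  rw [hleft]

end IsQuotientCoveringMap

end ContractibleCovering

/-! ### Partitions of unity subordinate to sheets of the covering -/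

/-- A smooth partition of unity on `S` subordinate to the images of sheets of `p`, together with the
group elements which move points to these sheets. -/
structure SheetPartition {S E : Type*} (G : Type*) [TopologicalSpace S]
    [ChartedSpace (EuclideanHalfSpace 2) S] [TopologicalSpace E] [Group G] [MulAction G E]
    (p : E → S) (e₀ : E) (ι : Type*) [Fintype ι] where
  /-- The functions of the partition. -/
  toFun : ι → S → ℝ
  contMDiff : ∀ i, ContMDiff (𝓡∂ 2) 𝓘(ℝ, ℝ) ∞ (toFun i)
  nonneg : ∀ i x, 0 ≤ toFun i x
  sum_eq_one : ∀ x, ∑ i, toFun i x = 1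
  /-- The group element moving a point to the sheet. -/
  sheet : ι → E → G
  eventually_sheet : ∀ e, ∃ g : ι → G, ∀ᶠ e' in 𝓝 e, ∀ i, toFun i (p e') = 0 ∨ sheet i e' = g i
  sheet_smul : ∀ i e (g : G), toFun i (p e) = 0 ∨ sheet i (g • e) = sheet i e * g⁻¹
  sheet_base : ∀ i, sheet i e₀ = 1

theorem exists_sheetPartition {S E G : Type*} [TopologicalSpace S] [CompactSpace S] [T2Space S]
    [ChartedSpace (EuclideanHalfSpace 2) S] [IsManifold (𝓡∂ 2) ∞ S] [TopologicalSpace E] [Group G]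
    [MulAction G E] {p : E → S} (hp : IsQuotientCoveringMap p G) (e₀ : E) :
    ∃ T : Finset E, Nonempty (SheetPartition G p e₀ T) := by
  classical
  have := hp.toContinuousConstSMul
  have hV : ∀ e : E, ∃ V : Set E, IsOpen V ∧ e ∈ V ∧
      ∀ g : G, ((g • ·) '' V ∩ V).Nonempty → g = 1 := by
    intro e
    obtain ⟨U, hU, hd⟩ := hp.disjoint e
    obtain ⟨V, hVU, hVo, heV⟩ := mem_nhds_iff.1 hU
    exact ⟨V, hVo, heV, fun g hg => hd g (hg.mono (by gcongr))⟩
  choose V hVo heV hVd using hV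
  have hpo := hp.isCoveringMap.isOpenMap
  obtain ⟨T, hT⟩ := isCompact_univ.elim_finite_subcover (fun e => p '' V e)
    (fun e => hpo _ (hVo e)) (fun x _ => by
      obtain ⟨e, rfl⟩ := hp.surjective x
      exact mem_iUnion.2 ⟨e, mem_image_of_mem p (heV e)⟩)
  obtain ⟨f, hf⟩ := SmoothPartitionOfUnity.exists_isSubordinate (𝓡∂ 2) isClosed_univ
    (fun i : T => p '' V i) (fun i => hpo _ (hVo i)) (fun x hx => by
      obtain ⟨i, hi, hx⟩ := mem_iUnion₂.1 (hT hx)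
      exact mem_iUnion.2 ⟨⟨i, hi⟩, hx⟩)
  have huniq : ∀ (i e : E) (g g' : G), g • e ∈ V i → g' • e ∈ V i → g = g' := by
    intro i e g g' h1 h2
    refine (mul_inv_eq_one.1 (hVd i (g * g'⁻¹) ⟨g • e, ⟨g' • e, h2, ?_⟩, h1⟩))
    dsimp only
    rw [smul_smul, inv_mul_cancel_right]
  -- The default value is taken only off the orbit of the sheet, where the weight `f i` vanishes.
  let γ : T → E → G := fun i e => if h : ∃ g : G, g • e ∈ V i then h.choose else 1
  have hγ : ∀ (i : T) (e : E) (g : G), g • e ∈ V i → γ i e = g := by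
    intro i e g hg
    have h : ∃ g : G, g • e ∈ V i := ⟨g, hg⟩
    have : γ i e = h.choose := dif_pos h
    rw [this]
    exact huniq _ _ _ _ h.choose_spec hg
  have hex : ∀ (i : T) (e : E), p e ∈ p '' V i → ∃ g : G, g • e ∈ V i := by
    rintro i e ⟨e', he', h⟩
    obtain ⟨g, rfl⟩ := hp.exists_smul_eq h.symm
    exact ⟨g, he'⟩
  have hsupp : ∀ (i : T) (x : S), f i x ≠ 0 → x ∈ p '' V i := fun i x hx =>
    hf i (subset_tsupport _ hx)
  -- Left multiplication by the inverse of the value at `e₀` gives the normalization at the base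
  -- point without disturbing equivariance on the right.
  refine ⟨T, ⟨⟨fun i => f i, fun i => (f i).contMDiff, fun i x => f.nonneg i x, fun x => ?_,
    fun i e => (γ i e₀)⁻¹ * γ i e, fun e => ?_, fun i e g => ?_, fun i => inv_mul_cancel _⟩⟩⟩
  · rw [← finsum_eq_sum_of_fintype]
    exact f.sum_eq_one (mem_univ x)
  · have : ∀ i : T, ∃ g : G, ∀ᶠ e' in 𝓝 e, f i (p e') = 0 ∨ (γ i e₀)⁻¹ * γ i e' = g := by
      intro i
      by_cases h : p e ∈ p '' V i
      · obtain ⟨g, hg⟩ := hex i e h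
        refine ⟨(γ i e₀)⁻¹ * g, ?_⟩
        have hev : ∀ᶠ e' in 𝓝 e, g • e' ∈ V i :=
          (continuous_const_smul g).continuousAt.eventually ((hVo i).mem_nhds hg)
        filter_upwards [hev] with e' he'
        exact Or.inr (by rw [hγ i e' g he'])
      · refine ⟨1, ?_⟩
        have hev : ∀ᶠ e' in 𝓝 e, p e' ∈ (tsupport (f i))ᶜ :=
          hp.isCoveringMap.continuous.continuousAt.eventually
            ((isClosed_tsupport _).isOpen_compl.mem_nhds fun h' => h (hf i h'))
        filter_upwards [hev] with e' he'
        exact Or.inl (image_eq_zero_of_notMem_tsupport he')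
    choose g hg using this
    exact ⟨g, eventually_all.2 hg⟩
  · by_cases h : f i (p e) = 0
    · exact Or.inl h
    · obtain ⟨g', hg'⟩ := hex i e (hsupp i _ h)
      refine Or.inr ?_
      rw [hγ i e g' hg', hγ i (g • e) (g' * g⁻¹) (by rwa [smul_smul, inv_mul_cancel_right]),
        mul_assoc]

/-! ## The suspension of a representation -/

/-- A fibrewise increasing bijection `E × ℝ → E × ℝ` is a homeomorphism. -/
def fiberwiseHomeomorph {E : Type*} [TopologicalSpace E] (f : E → ℝ → ℝ)
    (hf : Continuous fun z : E × ℝ => f z.1 z.2) (hm : ∀ e, StrictMono (f e))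
    (hs : ∀ e, Function.Surjective (f e)) : E × ℝ ≃ₜ E × ℝ where
  toFun z := (z.1, f z.1 z.2)
  invFun z := (z.1, (hs z.1 z.2).choose)
  left_inv z := Prod.ext rfl ((hm z.1).injective (hs z.1 (f z.1 z.2)).choose_spec)
  right_inv z := Prod.ext rfl (hs z.1 z.2).choose_spec
  continuous_toFun := continuous_fst.prodMk hf
  continuous_invFun := by
    refine continuous_fst.prodMk (continuous_iff_continuousAt.2 fun z => ?_)
    have hspec : ∀ w : E × ℝ, f w.1 (hs w.1 w.2).choose = w.2 := fun w => (hs w.1 w.2).choose_spec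
    have hfa : ∀ a : ℝ, Continuous fun w : E × ℝ => f w.1 a := fun a =>
      hf.comp (by fun_prop : Continuous fun w : E × ℝ => (w.1, a))
    refine tendsto_order.2 ⟨fun a ha => ?_, fun a ha => ?_⟩
    · have h1 : f z.1 a < z.2 := (hspec z) ▸ hm z.1 ha
      filter_upwards [(isOpen_lt (hfa a) continuous_snd).mem_nhds h1] with w hw
      exact (hm w.1).lt_iff_lt.1 (by rw [hspec]; exact hw)
    · have h1 : z.2 < f z.1 a := by
        conv_lhs => rw [← hspec z]
        exact hm z.1 ha
      filter_upwards [(isOpen_lt continuous_snd (hfa a)).mem_nhds h1] with w hw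
      exact (hm w.1).lt_iff_lt.1 (by rw [hspec]; exact hw)

section Heights

variable {S E G ι : Type*} [TopologicalSpace S] [ChartedSpace (EuclideanHalfSpace 2) S]
  [TopologicalSpace E] [Group G] [MulAction G E] [Fintype ι] {p : E → S} {e₀ : E}
  (P : SheetPartition G p e₀ ι) (κ : G →* (I ≃ₜ I))

/-- The height of the leaf `t` of the suspension over the point `e`, for `t` in the unit interval
(extended by the identity). -/
def fiberHeight (e : E) (t : ℝ) : ℝ :=
  ∑ i, P.toFun i (p e) * unitExtension (κ (P.sheet i e)) t

variable {κ}

lemma isUnitMap_fiberHeight (hκ : ∀ g, Monotone (κ g)) (e : E) : IsUnitMap (fiberHeight P κ e) :=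
  IsUnitMap.sum (fun _ => isUnitMap_unitExtension (hκ _)) (fun i => P.nonneg i _)
    (P.sum_eq_one _)

lemma fiberHeight_base (t : ℝ) : fiberHeight P κ e₀ t = t := by
  simp only [fiberHeight, P.sheet_base, map_one, unitExtension_one]
  rw [← Finset.sum_mul, P.sum_eq_one, one_mul]

/-- Moving `e` by `g` multiplies each sheet element on the right by `g⁻¹`, which cancels `κ g`; the
weights depend only on `p e`. -/
lemma fiberHeight_smul (hp : IsQuotientCoveringMap p G) (hκ : ∀ g, Monotone (κ g)) (g : G) (e : E)
    (t : ℝ) : fiberHeight P κ (g • e) (unitExtension (κ g) t) = fiberHeight P κ e t := by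
  refine Finset.sum_congr rfl fun i _ => ?_
  rw [hp.map_smul]
  rcases P.sheet_smul i e g with h | h
  · rw [h, zero_mul, zero_mul]
  · rw [h, ← unitExtension_mul (hκ _) (hκ _), ← map_mul, inv_mul_cancel_right]

/-- Locally only the weights vary, so the regularity of the heights reduces to that of the partition
and of finitely many maps `κ (g i)`. -/
lemma exists_fiberHeight_eq (e : E) : ∃ g : ι → G, ∀ᶠ e' in 𝓝 e, ∀ t,
    fiberHeight P κ e' t = ∑ i, P.toFun i (p e') * unitExtension (κ (g i)) t := by
  obtain ⟨g, hg⟩ := P.eventually_sheet e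
  refine ⟨g, hg.mono fun e' he' t => Finset.sum_congr rfl fun i _ => ?_⟩
  rcases he' i with h | h
  · rw [h, zero_mul, zero_mul]
  · rw [h]

lemma continuous_fiberHeight (hp : Continuous p) (hκ : ∀ g, Monotone (κ g)) :
    Continuous fun z : E × ℝ => fiberHeight P κ z.1 z.2 := by
  rw [continuous_iff_continuousAt]
  intro z
  obtain ⟨g, hg⟩ := exists_fiberHeight_eq P (κ := κ) z.1
  have h1 : ∀ᶠ w in 𝓝 z, fiberHeight P κ w.1 w.2 =
      ∑ i, P.toFun i (p w.1) * unitExtension (κ (g i)) w.2 :=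
    (continuous_fst.continuousAt.eventually hg).mono fun w hw => hw w.2
  refine ContinuousAt.congr ?_ (h1.mono fun w hw => hw.symm)
  have h2 := fun i => (P.contMDiff i).continuous
  have h3 := fun i => (isUnitMap_unitExtension (hκ (g i))).continuous
  fun_prop

variable (κ) (ψ : E ≃ₜ E)

/-- The height of the leaf `t` of the suspension over the point `e`, for the infinite cyclic
covering of a mapping torus whose monodromy lifts to `ψ`. -/
def suspensionHeight (e : E) (t : ℝ) : ℝ := assemble (fun n => fiberHeight P κ ((ψ ^ n) e)) t

/-- The action of the deck transformations on the heights. -/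
def deckHeight (c : ℤ → G → G) (g : G) (t : ℝ) : ℝ :=
  assemble (fun n => unitExtension (κ (c n g))) t

variable {κ}

lemma floor_suspensionHeight (hκ : ∀ g, Monotone (κ g)) (e : E) (t : ℝ) :
    ⌊suspensionHeight P κ ψ e t⌋ = ⌊t⌋ :=
  floor_assemble (fun _ => isUnitMap_fiberHeight P hκ _) t

lemma strictMono_suspensionHeight (hκ : ∀ g, Monotone (κ g)) (e : E) :
    StrictMono (suspensionHeight P κ ψ e) :=
  strictMono_assemble fun _ => isUnitMap_fiberHeight P hκ _

lemma suspensionHeight_eq (hκ : ∀ g, Monotone (κ g)) (e : E) {n : ℤ} {t : ℝ}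
    (ht : t ∈ Ioo ((n : ℝ) - 1) (n + 1)) :
    suspensionHeight P κ ψ e t = t + (fiberHeight P κ ((ψ ^ n) e) (t - n) - (t - n)) +
      (fiberHeight P κ ((ψ ^ (n - 1)) e) (t - n + 1) - (t - n + 1)) :=
  assemble_eq_on_Ioo (fun _ => isUnitMap_fiberHeight P hκ _) ht

lemma suspensionHeight_base (hκ : ∀ g, Monotone (κ g)) {t : ℝ} (ht : t ∈ Icc (0 : ℝ) 1) :
    suspensionHeight P κ ψ e₀ t = t := by
  rw [suspensionHeight, assemble_eq_on_Icc (fun _ => isUnitMap_fiberHeight P hκ _) ht, zpow_zero]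
  exact fiberHeight_base P t

lemma suspensionHeight_mem_Icc_iff (hκ : ∀ g, Monotone (κ g)) (e : E) {t : ℝ} :
    suspensionHeight P κ ψ e t ∈ Icc (0 : ℝ) 1 ↔ t ∈ Icc (0 : ℝ) 1 := by
  have h : ∀ t : ℝ, t = 0 ∨ t = 1 → suspensionHeight P κ ψ e t = t := by
    intro t ht
    have hu := isUnitMap_fiberHeight P hκ ((ψ ^ (0 : ℤ)) e)
    rw [suspensionHeight, assemble_eq_on_Icc (fun _ => isUnitMap_fiberHeight P hκ _)
      (by rcases ht with rfl | rfl <;> simp)]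
    rcases ht with rfl | rfl
    · exact hu.eq_of_le 0 le_rfl
    · exact hu.eq_of_ge 1 le_rfl
  have hm := strictMono_suspensionHeight P ψ hκ e
  have h0 := hm.le_iff_le (a := 0) (b := t)
  have h1 := hm.le_iff_le (a := t) (b := 1)
  rw [h 0 (Or.inl rfl)] at h0
  rw [h 1 (Or.inr rfl)] at h1
  rw [mem_Icc, mem_Icc, h0, h1]

lemma continuous_suspensionHeight (hp : Continuous p) (hκ : ∀ g, Monotone (κ g)) :
    Continuous fun z : E × ℝ => suspensionHeight P κ ψ z.1 z.2 := by
  rw [continuous_iff_continuousAt]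
  intro z
  have h1 : ∀ᶠ w : E × ℝ in 𝓝 z, w.2 ∈ Ioo ((⌊z.2⌋ : ℝ) - 1) (⌊z.2⌋ + 1) :=
    continuous_snd.continuousAt.eventually (isOpen_Ioo.mem_nhds (mem_Ioo_floor z.2))
  refine ContinuousAt.congr ?_ (h1.mono fun w hw => (suspensionHeight_eq P ψ hκ w.1 hw).symm)
  have hc := continuous_fiberHeight P hp hκ
  have h2 := fun (k : ℤ) (a : ℝ) => hc.comp (((ψ ^ k).continuous.comp continuous_fst).prodMk
    (continuous_snd.sub (continuous_const (y := a))) :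
      Continuous fun w : E × ℝ => ((ψ ^ k) w.1, w.2 - a))
  have h3 := h2 ⌊z.2⌋ ⌊z.2⌋
  have h4 := h2 (⌊z.2⌋ - 1) (⌊z.2⌋ - 1)
  simp only [Function.comp_def, sub_sub_eq_add_sub, add_sub_right_comm] at h3 h4
  fun_prop

lemma surjective_suspensionHeight (hp : Continuous p) (hκ : ∀ g, Monotone (κ g)) (e : E) :
    Function.Surjective (suspensionHeight P κ ψ e) :=
  surjective_of_floor_eq ((continuous_suspensionHeight P ψ hp hκ).comp
    (by fun_prop : Continuous fun t : ℝ => (e, t))) (floor_suspensionHeight P ψ hκ e)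

lemma suspensionHeight_zpow (e : E) (t : ℝ) (m : ℤ) :
    suspensionHeight P κ ψ ((ψ ^ m) e) (t - m) = suspensionHeight P κ ψ e t - m := by
  rw [suspensionHeight, suspensionHeight, ← assemble_sub_int]
  congr 1
  funext n
  rw [zpow_add]
  rfl

variable {c : ℤ → G → G}

lemma suspensionHeight_smul (hp : IsQuotientCoveringMap p G) (hκ : ∀ g, Monotone (κ g))
    (hc : ∀ n g e, (ψ ^ n) (g • e) = c n g • (ψ ^ n) e) (g : G) (e : E) (t : ℝ) :
    suspensionHeight P κ ψ (g • e) (deckHeight κ c g t) = suspensionHeight P κ ψ e t := by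
  rw [suspensionHeight, deckHeight,
    ← assemble_comp (fun n => isUnitMap_unitExtension (hκ (c n g)))]
  simp only [hc, fiberHeight_smul P hp hκ]
  rfl

end Heights

/-! ### Equivariance of the iterates of the lifted monodromy -/

section Equivariance

variable {S E G : Type*} [TopologicalSpace E] [Group G] [MulAction G E] {p : E → S} {ψ : E ≃ₜ E}

lemma proj_zpow {χ : Equiv.Perm S} (hψ : ∀ e, p (ψ e) = χ (p e)) (n : ℤ) (e : E) :
    p ((ψ ^ n) e) = (χ ^ n) (p e) := by
  have hinv : ∀ e, p (ψ⁻¹ e) = χ⁻¹ (p e) := by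
    intro e
    have h := hψ (ψ⁻¹ e)
    rw [show ψ (ψ⁻¹ e) = e from ψ.apply_symm_apply e] at h
    rw [h]
    exact (χ.symm_apply_apply _).symm
  induction n using Int.induction_on generalizing e with
  | zero => rfl
  | succ n ih =>
    rw [zpow_add_one, zpow_add_one]
    exact (ih (ψ e)).trans (by rw [hψ]; rfl)
  | pred n ih =>
    rw [zpow_sub_one, zpow_sub_one]
    exact (ih (ψ⁻¹ e)).trans (by rw [hinv]; rfl)

variable [TopologicalSpace S]

lemma equivariance_one (hp : IsQuotientCoveringMap p G) {f : E → E} {a : G → G}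
    (h : ∀ g e, f (g • e) = a g • f e) (e : E) : a 1 = 1 := by
  refine hp.eq_of_smul_eq_smul (e := f e) ?_
  rw [← h, one_smul, one_smul]

lemma equivariance_mul (hp : IsQuotientCoveringMap p G) {f : E → E} {a : G → G}
    (h : ∀ g e, f (g • e) = a g • f e) (e : E) (g g' : G) : a (g * g') = a g * a g' := by
  refine hp.eq_of_smul_eq_smul (e := f e) ?_
  rw [← h, mul_smul, mul_smul, h, h]

lemma equivariance_injective (hp : IsQuotientCoveringMap p G) {f : E → E} {a : G → G}
    (hf : Function.Injective f) (h : ∀ g e, f (g • e) = a g • f e) (e : E) :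
    Function.Injective a := by
  intro g g' hg
  refine hp.eq_of_smul_eq_smul (e := e) (hf ?_)
  rw [h, h, hg]

end Equivariance

lemma IsLocalHomeomorph.prodMap_id {X Y Z : Type*} [TopologicalSpace X] [TopologicalSpace Y]
    [TopologicalSpace Z] {f : X → Y} (hf : IsLocalHomeomorph f) :
    IsLocalHomeomorph (Prod.map f (fun z : Z => z)) :=
  IsLocalHomeomorph.mk _ fun x => by
    obtain ⟨Φ, hΦ, rfl⟩ := hf x.1
    exact ⟨Φ.prod (OpenPartialHomeomorph.refl Z), ⟨hΦ, mem_univ _⟩, fun _ _ => rfl⟩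

/-! ### Genericity of the action on heights -/

section DeckHeight

variable {G : Type*} [Group G] {κ : G →* (I ≃ₜ I)} {c : ℤ → G → G}

lemma continuous_deckHeight (hκ : ∀ g, Monotone (κ g)) (c : ℤ → G → G) (g : G) :
    Continuous (deckHeight κ c g) :=
  continuous_assemble fun n => isUnitMap_unitExtension (hκ (c n g))

lemma eq_one_of_eventually_deckHeight (hgen : IsGeneric κ)
    (hc1 : ∀ n g, c n g = 1 → g = 1) {g : G} {t : ℝ}
    (h : ∀ᶠ s in 𝓝 t, deckHeight κ c g s = s) : g = 1 := by
  obtain ⟨δ, hδ, hball⟩ := Metric.eventually_nhds_iff.1 h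
  have hfr : Int.fract t < 1 := Int.fract_lt_one t
  have hfr0 : 0 ≤ Int.fract t := Int.fract_nonneg t
  -- Genericity speaks only of interior points of `I`. A point just above the fractional part is
  -- interior even when `t` is an integer.
  obtain ⟨r, hr1, hr2⟩ : ∃ r, Int.fract t < r ∧ r < min 1 (Int.fract t + δ) :=
    exists_between (lt_min hfr (by linarith))
  rw [lt_min_iff] at hr2
  have hfix : ∀ r' : ℝ, Int.fract t < r' → r' < 1 → r' < Int.fract t + δ →
      unitExtension (κ (c ⌊t⌋ g)) r' = r' := by
    intro r' h1 h2 h3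
    have h4 : ⌊(⌊t⌋ : ℝ) + r'⌋ = ⌊t⌋ :=
      Int.floor_eq_iff.2 ⟨by linarith, by linarith⟩
    have h5 := hball (y := ⌊t⌋ + r') (by
      rw [Real.dist_eq, abs_lt]
      have := Int.floor_add_fract t
      constructor <;> linarith)
    rw [deckHeight, assemble, Int.fract, h4, add_sub_cancel_left] at h5
    linarith
  refine hc1 ⌊t⌋ g (by_contra fun hne => ?_)
  have hrI : r ∈ Icc (0 : ℝ) 1 := ⟨by linarith, hr2.1.le⟩
  have hfix' : ∀ r' : I, Int.fract t < r' → (r' : ℝ) < 1 → (r' : ℝ) < Int.fract t + δ →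
      κ (c ⌊t⌋ g) r' = r' := fun r' h1 h2 h3 =>
    Subtype.ext (by rw [← unitExtension_coe]; exact hfix _ h1 h2 h3)
  have hev := hgen _ hne ⟨r, hrI⟩ (by rw [← Subtype.coe_lt_coe]; simp; linarith)
    (by rw [← Subtype.coe_lt_coe]; exact hr2.1) (hfix' _ hr1 hr2.1 hr2.2)
  have hop : ∀ᶠ r' : I in 𝓝 (⟨r, hrI⟩ : I),
      (r' : ℝ) ∈ Ioo (Int.fract t) (min 1 (Int.fract t + δ)) :=
    continuous_subtype_val.continuousAt.eventually
      (isOpen_Ioo.mem_nhds ⟨hr1, lt_min hr2.1 hr2.2⟩)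
  have hne' : (𝓝[≠] (⟨r, hrI⟩ : I)).NeBot := inferInstance
  obtain ⟨r', h1, h2, h3⟩ := (hev.and (hop.filter_mono nhdsWithin_le_nhds)).exists
  rw [lt_min_iff] at h3
  exact h1 (hfix' r' h2 h3.1 h3.2)

end DeckHeight

/-! ### The developing map and the suspension property -/

section Suspension

variable {S N E G ι : Type*} [TopologicalSpace S] [ChartedSpace (EuclideanHalfSpace 2) S]
  [TopologicalSpace E] [Group G] [MulAction G E] [Fintype ι] {p : E → S} {e₀ : E}

/-- The map from `E × ℝ` to the mapping torus which straightens the suspension. -/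
def developingMap (P : SheetPartition G p e₀ ι) (κ : G →* (I ≃ₜ I)) (ψ : E ≃ₜ E) (q : S × ℝ → N)
    (z : E × ℝ) : N :=
  q (p z.1, suspensionHeight P κ ψ z.1 z.2)

variable [TopologicalSpace N] {P : SheetPartition G p e₀ ι} {κ : G →* (I ≃ₜ I)} {ψ : E ≃ₜ E} {c : ℤ → G → G}
  {φ : S ≃ₘ^∞⟮𝓡∂ 2, 𝓡∂ 2⟯ S} {q : S × ℝ → N}

theorem isFoliatedCover_developingMap [ChartedSpace HalfSpaceProd N]
    (hp : IsQuotientCoveringMap p G) (hκ : ∀ g, Monotone (κ g))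
    (hgen : IsGeneric κ) (hψ : ∀ e, p (ψ e) = φ (p e))
    (hc : ∀ n g e, (ψ ^ n) (g • e) = c n g • (ψ ^ n) e) (hq : IsMappingTorus φ q) :
    IsFoliatedCover G (developingMap P κ ψ q) (deckHeight κ c) := by
  have hpc := hp.isCoveringMap.continuous
  have := hp.toContinuousConstSMul
  have hfl := floor_suspensionHeight P ψ hκ
  have hinj := fun e => (strictMono_suspensionHeight P ψ hκ e).injective
  have hψn : ∀ (n : ℤ) e, p ((ψ ^ n) e) = ((φ.toEquiv : Equiv.Perm S) ^ n) (p e) :=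
    proj_zpow hψ
  have hshift : ∀ (n : ℤ) e t,
      developingMap P κ ψ q ((ψ ^ n) e, t - n) = developingMap P κ ψ q (e, t) := by
    intro n e t
    refine ((hq.eq_iff _ _ _ _).2 ⟨n, hψn n e, ?_⟩).symm
    exact suspensionHeight_zpow P ψ e t n
  have hsmul : ∀ g e t,
      developingMap P κ ψ q (g • e, deckHeight κ c g t) = developingMap P κ ψ q (e, t) := by
    intro g e t
    simp only [developingMap, hp.map_smul, suspensionHeight_smul P ψ hp hκ hc]
  -- The power of `ψ` is visible in the integer parts of the heights; equal heights therefore force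
  -- `n = 0`.
  have hQ : ∀ e e' t t', developingMap P κ ψ q (e, t) = developingMap P κ ψ q (e', t') →
      ∃ (n : ℤ) (g : G), g • (ψ ^ n) e = e' ∧ deckHeight κ c g (t - n) = t' ∧
        ⌊t'⌋ = ⌊t⌋ - n := by
    intro e e' t t' h
    obtain ⟨n, h1, h2⟩ := (hq.eq_iff _ _ _ _).1 h
    dsimp only at h1 h2
    rw [← hψn] at h1
    obtain ⟨g, rfl⟩ := hp.exists_smul_eq h1.symm
    refine ⟨n, g, rfl, hinj (g • (ψ ^ n) e) ?_, ?_⟩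
    · rw [h2, suspensionHeight_smul P ψ hp hκ hc, suspensionHeight_zpow]
    · rw [← hfl (g • (ψ ^ n) e), h2, Int.floor_sub_intCast, hfl]
  refine ⟨?_, ?_, ?_, ?_, ?_, hsmul, ?_, ?_⟩
  · intro y
    obtain ⟨⟨x, r⟩, rfl⟩ := hq.surjective y
    obtain ⟨e, rfl⟩ := hp.surjective x
    obtain ⟨t, rfl⟩ := surjective_suspensionHeight P ψ hpc hκ e r
    exact ⟨(e, t), rfl⟩
  · have h1 := (fiberwiseHomeomorph _ (continuous_suspensionHeight P ψ hpc hκ)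
      (strictMono_suspensionHeight P ψ hκ)
      (surjective_suspensionHeight P ψ hpc hκ)).isLocalHomeomorph
    have h2 : IsLocalHomeomorph (Prod.map p (fun t : ℝ => t)) :=
      hp.isCoveringMap.isLocalHomeomorph.prodMap_id
    exact hq.localDiffeo.isLocalHomeomorph.comp (h2.comp h1)
  · intro e e' t t' h
    obtain ⟨n, g, rfl, rfl, -⟩ := hQ _ _ _ _ h
    refine ⟨fun a => g • (ψ ^ n) a, fun s => deckHeight κ c g (s - n), by fun_prop,
      (MulAction.injective g).comp (ψ ^ n).injective,
      (continuous_deckHeight hκ c g).comp (by fun_prop), fun a s => ?_, rfl, rfl⟩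
    rw [hsmul, hshift]
  · intro t
    have h1 : unitExtension 1 = fun t => t := funext unitExtension_one
    simp only [deckHeight, fun n => equivariance_one hp (hc n) e₀, map_one, h1]
    exact assemble_id t
  · intro g g' t
    rw [deckHeight, deckHeight, deckHeight,
      ← assemble_comp (fun n => isUnitMap_unitExtension (hκ (c n g')))]
    congr 1
    funext n s
    rw [equivariance_mul hp (hc n) e₀, map_mul, unitExtension_mul (hκ _) (hκ _)]
  · intro e e' t h
    obtain ⟨n, g, h1, h2, h3⟩ := hQ _ _ _ _ h
    obtain rfl : n = 0 := by omega
    exact ⟨g, h1, by simpa using h2⟩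
  · intro g t h
    refine eq_one_of_eventually_deckHeight hgen (fun n g hg => ?_) h
    exact equivariance_injective hp (ψ ^ n).injective (hc n) e₀
      (hg.trans (equivariance_one hp (hc n) e₀).symm)

/-- Leafwise lifts of a path are the graphs of the height at a constant `t` along a lift to `E`. For
a loop lifted from `e₀` to `g • e₀`, equivariance and the normalization at `e₀` give the final
height `κ g⁻¹` of the initial one. -/
theorem isSuspension_foliation [PreconnectedSpace E]
    {𝒞 : Set (OpenPartialHomeomorph E (EuclideanHalfSpace 2))}
    (h𝒞 : ∀ e, ∃ C ∈ 𝒞, e ∈ C.source)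
    (hQ : IsFoliatedCover G (developingMap P κ ψ q) (deckHeight κ c))
    (hp : IsQuotientCoveringMap p G) (hκ : ∀ g, Monotone (κ g))
    (hc : ∀ n g e, (ψ ^ n) (g • e) = c n g • (ψ ^ n) e)
    {x₀ : S} (hx₀ : p e₀ = x₀) (ρ : FundamentalGroup S x₀ →* (I ≃ₜ I))
    (hρ : ∀ (γ : Path x₀ x₀) (L : C(I, E)) (g : G), L 0 = e₀ → (∀ s, p (L s) = γ s) →
      L 1 = g • e₀ → ρ (FundamentalGroup.fromPath (Path.Homotopic.Quotient.mk γ)) = κ g⁻¹) :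
    (hQ.foliation h𝒞).IsSuspension q ρ := by
  have hpc := hp.isCoveringMap.continuous
  have hcont := continuous_suspensionHeight P ψ hpc hκ
  have hinj := fun e => (strictMono_suspensionHeight P ψ hκ e).injective
  have hmem := fun e t => suspensionHeight_mem_Icc_iff P ψ hκ e (t := t)
  have hsurj := surjective_suspensionHeight P ψ hpc hκ
  have hlift : ∀ (L : C(I, E)) (u : C(I, I)),
      (hQ.foliation h𝒞).IsLeafwise (fun s => q (p (L s), (u s : ℝ))) →
      ∃ t, ∀ s, (u s : ℝ) = suspensionHeight P κ ψ (L s) t := by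
    intro L u hu
    let Ψ := fiberwiseHomeomorph _ hcont (strictMono_suspensionHeight P ψ hκ) hsurj
    have hz : ∀ s, suspensionHeight P κ ψ (L s) (Ψ.symm (L s, u s)).2 = u s := fun s =>
      congrArg Prod.snd (Ψ.apply_symm_apply (L s, (u s : ℝ)))
    have hw : Continuous fun s => (Ψ.symm (L s, (u s : ℝ))).2 := by fun_prop
    have hl : (hQ.foliation h𝒞).IsLeafwise fun s =>
        developingMap P κ ψ q (L s, (Ψ.symm (L s, (u s : ℝ))).2) := by
      simp only [developingMap, hz]
      exact hu
    refine ⟨(Ψ.symm (L 0, (u 0 : ℝ))).2, fun s => ?_⟩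
    rw [← hz s, hQ.eq_of_isLeafwise h𝒞 L.continuous hw hl s 0]
  constructor
  · intro γ θ
    obtain ⟨e, he⟩ := hp.surjective (γ 0)
    obtain ⟨L, hL, hL0⟩ := hp.isCoveringMap.exists_path_lifts γ e he.symm
    have hL' : ∀ s, p (L s) = γ s := fun s => congrFun hL s
    obtain ⟨t, ht⟩ := hsurj (L 0) θ
    have htI : t ∈ Icc (0 : ℝ) 1 := (hmem _ _).1 (ht ▸ θ.2)
    refine ⟨⟨fun s => ⟨suspensionHeight P κ ψ (L s) t, (hmem _ _).2 htI⟩,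
      (hcont.comp (by fun_prop : Continuous fun s => (L s, t))).subtype_mk _⟩,
      ⟨Subtype.ext ht, ?_⟩, ?_⟩
    · have := hQ.isLeafwise h𝒞 t L.continuous
      simp only [developingMap, hL'] at this
      exact this
    · rintro u ⟨hu0, hu⟩
      obtain ⟨t', ht'⟩ := hlift L u (by simpa only [hL'] using hu)
      have h1 : t' = t := hinj (L 0) (by rw [← ht', hu0, ht])
      subst h1
      exact ContinuousMap.ext fun s => Subtype.ext (ht' s)
  · intro γ u hu
    obtain ⟨L, hL, hL0⟩ := hp.isCoveringMap.exists_path_lifts γ.toContinuousMap e₀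
      (γ.source.trans hx₀.symm)
    have hL' : ∀ s, p (L s) = γ s := fun s => congrFun hL s
    obtain ⟨t, ht⟩ := hlift L u (by simpa only [hL'] using hu)
    have htI : t ∈ Icc (0 : ℝ) 1 := (hmem (L 0) t).1 (ht 0 ▸ (u 0).2)
    have ht0 : (u 0 : ℝ) = t := by rw [ht, hL0, suspensionHeight_base P ψ hκ htI]
    obtain ⟨g, hg⟩ := hp.exists_smul_eq (e := e₀) (e' := L 1)
      (by rw [hL', γ.target, hx₀])
    rw [hρ γ L g hL0 hL' hg.symm]
    refine Subtype.ext ?_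
    have h1 : t = deckHeight κ c g (deckHeight κ c g⁻¹ t) := by
      rw [← hQ.mul_height, mul_inv_cancel, hQ.one_height]
    have hc0 : c 0 g⁻¹ = g⁻¹ := by
      refine hp.eq_of_smul_eq_smul (e := e₀) ?_
      have := hc 0 g⁻¹ e₀
      rw [zpow_zero] at this
      exact this.symm
    have h2 : deckHeight κ c g⁻¹ t = κ g⁻¹ (u 0) := by
      rw [deckHeight, assemble_eq_on_Icc (fun n => isUnitMap_unitExtension (hκ _)) htI, hc0, ← ht0,
        unitExtension_coe]
    rw [ht, ← hg, h1, suspensionHeight_smul P ψ hp hκ hc, h2,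
      suspensionHeight_base P ψ hκ (κ g⁻¹ (u 0)).2]

end Suspension

/-! ## Smoothness of the heights -/

section Flat

variable {f : ℝ → ℝ}

/-- One-sided derivatives agree at the endpoints. The derivative is again an extension by zero,
which allows induction on the order of smoothness. -/
lemma hasDerivAt_of_flat (hf : ContDiffOn ℝ 1 f (Icc 0 1)) (h0 : ∀ t ≤ 0, f t = 0)
    (h1 : ∀ t, 1 ≤ t → f t = 0) (hd0 : derivWithin f (Icc 0 1) 0 = 0)
    (hd1 : derivWithin f (Icc 0 1) 1 = 0) (t : ℝ) :
    HasDerivAt f ((Icc (0 : ℝ) 1).indicator (derivWithin f (Icc 0 1)) t) t := by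
  have hin : ∀ t ∈ Icc (0 : ℝ) 1, HasDerivWithinAt f (derivWithin f (Icc 0 1) t) (Icc 0 1) t :=
    fun t ht => (hf.differentiableOn one_ne_zero t ht).hasDerivWithinAt
  have hle : ∀ t ≤ 0, HasDerivWithinAt f 0 (Iic 0) t := fun t ht =>
    (hasDerivWithinAt_const t (Iic 0) (0 : ℝ)).congr h0 (h0 t ht)
  have hge : ∀ t, 1 ≤ t → HasDerivWithinAt f 0 (Ici 1) t := fun t ht =>
    (hasDerivWithinAt_const t (Ici 1) (0 : ℝ)).congr h1 (h1 t ht)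
  rcases lt_trichotomy t 0 with h | rfl | h
  · rw [indicator_of_notMem fun h' : t ∈ Icc (0 : ℝ) 1 => h'.1.not_gt h]
    exact (hle t h.le).hasDerivAt (Iic_mem_nhds h)
  · have h := hin 0 (by simp)
    rw [indicator_of_mem (by simp)]
    rw [hd0] at h ⊢
    refine ((hle 0 le_rfl).union h).hasDerivAt ?_
    rw [Iic_union_Icc_eq_Iic zero_le_one]
    exact Iic_mem_nhds zero_lt_one
  rcases lt_trichotomy t 1 with h' | rfl | h'
  · rw [indicator_of_mem (show t ∈ Icc (0 : ℝ) 1 from ⟨h.le, h'.le⟩)]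
    exact (hin t ⟨h.le, h'.le⟩).hasDerivAt (Icc_mem_nhds h h')
  · have h := hin 1 (by simp)
    rw [indicator_of_mem (by simp)]
    rw [hd1] at h ⊢
    refine (h.union (hge 1 le_rfl)).hasDerivAt ?_
    rw [Icc_union_Ici_eq_Ici zero_le_one]
    exact Ici_mem_nhds zero_lt_one
  · rw [indicator_of_notMem fun h'' : t ∈ Icc (0 : ℝ) 1 => h''.2.not_gt h']
    exact (hge t h'.le).hasDerivAt (Ici_mem_nhds h')

/-- A function which is smooth on the unit interval and flat at its endpoints extends by zero to a
smooth function. -/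
lemma contDiff_of_flat (hf : ContDiffOn ℝ ∞ f (Icc 0 1)) (h0 : ∀ t ≤ 0, f t = 0)
    (h1 : ∀ t, 1 ≤ t → f t = 0) (hd0 : ∀ n, iteratedDerivWithin n f (Icc 0 1) 0 = 0)
    (hd1 : ∀ n, iteratedDerivWithin n f (Icc 0 1) 1 = 0) : ContDiff ℝ ∞ f := by
  refine contDiff_infty.2 fun n => ?_
  have huniq : UniqueDiffOn ℝ (Icc (0 : ℝ) 1) := uniqueDiffOn_Icc zero_lt_one
  have key : ∀ (f : ℝ → ℝ), ContDiffOn ℝ ∞ f (Icc 0 1) → (∀ t ≤ 0, f t = 0) →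
      (∀ t, 1 ≤ t → f t = 0) → (∀ n, iteratedDerivWithin n f (Icc 0 1) 0 = 0) →
      (∀ n, iteratedDerivWithin n f (Icc 0 1) 1 = 0) →
      ∀ t, HasDerivAt f ((Icc (0 : ℝ) 1).indicator (derivWithin f (Icc 0 1)) t) t := by
    intro f hf h0 h1 hd0 hd1
    refine hasDerivAt_of_flat (hf.of_le (by norm_cast)) h0 h1 ?_ ?_
    · simpa [iteratedDerivWithin_one] using hd0 1
    · simpa [iteratedDerivWithin_one] using hd1 1
  induction n generalizing f with
  | zero =>
    exact contDiff_zero.2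
      (continuous_iff_continuousAt.2 fun t => (key f hf h0 h1 hd0 hd1 t).continuousAt)
  | succ n ih =>
    have hder := key f hf h0 h1 hd0 hd1
    have hds := funext fun t => (hder t).deriv
    have heq : EqOn ((Icc (0 : ℝ) 1).indicator (derivWithin f (Icc 0 1)))
        (derivWithin f (Icc 0 1)) (Icc 0 1) := fun t ht => indicator_of_mem ht _
    have hit : ∀ n, ∀ t ∈ Icc (0 : ℝ) 1,
        iteratedDerivWithin n ((Icc (0 : ℝ) 1).indicator (derivWithin f (Icc 0 1))) (Icc 0 1) t =
          iteratedDerivWithin (n + 1) f (Icc 0 1) t := by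
      intro n t ht
      rw [iteratedDerivWithin_congr heq ht, iteratedDerivWithin_succ']
    push_cast
    rw [contDiff_succ_iff_deriv]
    refine ⟨fun t => (hder t).differentiableAt, by simp, ?_⟩
    rw [hds]
    refine ih ((hf.derivWithin huniq (by norm_cast)).congr heq) (fun t ht => ?_)
      (fun t ht => ?_) (fun n => ?_) (fun n => ?_)
    · rcases ht.lt_or_eq with h | rfl
      · exact indicator_of_notMem (fun h' => h'.1.not_gt h) _
      · rw [heq (by simp)]
        simpa [iteratedDerivWithin_one] using hd0 1
    · rcases ht.lt_or_eq with h | rfl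
      · exact indicator_of_notMem (fun h' => h'.2.not_gt h) _
      · rw [heq (by simp)]
        simpa [iteratedDerivWithin_one] using hd1 1
    · rw [hit n 0 (by simp), hd0]
    · rw [hit n 1 (by simp), hd1]

end Flat

section Tapered

variable {g : I ≃ₜ I}

lemma contDiff_unitExtension (hg : Monotone g) (ht : IsTaperedDiffeo g) :
    ContDiff ℝ ∞ (unitExtension g) := by
  have heq : EqOn (displacement g) (fun t => realExtension g t - t) (Icc 0 1) := by
    intro t ht
    simp only [displacement, realExtension, projIcc_of_mem _ ht]
  refine contDiff_id.add (contDiff_of_flat ((ht.smooth.sub contDiffOn_id).congr heq)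
    (fun t => displacement_of_le hg) (fun t => displacement_of_ge hg) (fun n => ?_) (fun n => ?_))
  · rw [iteratedDerivWithin_congr heq (by simp), ht.tangent_zero]
  · rw [iteratedDerivWithin_congr heq (by simp), ht.tangent_one]

/-- The chain rule for the composite with the inverse excludes zero, and monotonicity excludes
negative values. -/
lemma deriv_unitExtension_pos (hg : Monotone g) (hg' : Monotone ⇑g⁻¹) (ht : IsTaperedDiffeo g)
    (ht' : IsTaperedDiffeo g⁻¹) (t : ℝ) : 0 < deriv (unitExtension g) t := by
  have hd : Differentiable ℝ (unitExtension g) :=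
    (contDiff_unitExtension hg ht).differentiable (by simp)
  have hd' : Differentiable ℝ (unitExtension g⁻¹) :=
    (contDiff_unitExtension hg' ht').differentiable (by simp)
  have hcomp : unitExtension g⁻¹ ∘ unitExtension g = id := by
    funext s
    rw [Function.comp_apply, ← unitExtension_mul hg' hg, inv_mul_cancel, unitExtension_one, id]
  have hchain := ((hd' _).hasDerivAt.comp t (hd t).hasDerivAt).deriv
  rw [hcomp, deriv_id] at hchain
  exact lt_of_le_of_ne (isUnitMap_unitExtension hg).strictMono.monotone.deriv_nonneg
    fun h => by rw [← h, mul_zero] at hchain; exact one_ne_zero hchain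

lemma deriv_unitExtension_of_ge (hg : Monotone g) (ht : IsTaperedDiffeo g) {t : ℝ} (h : 1 ≤ t) :
    deriv (unitExtension g) t = 1 := by
  have hd : Differentiable ℝ (unitExtension g) :=
    (contDiff_unitExtension hg ht).differentiable (by simp)
  have h1 : HasDerivWithinAt (unitExtension g) 1 (Ici 1) t :=
    (hasDerivWithinAt_id t _).congr (fun s hs => (isUnitMap_unitExtension hg).eq_of_ge s hs)
      ((isUnitMap_unitExtension hg).eq_of_ge t h)
  exact (uniqueDiffOn_Ici 1 t h).eq_deriv _ (hd t).hasDerivAt.hasDerivWithinAt h1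

end Tapered

section Implicit

variable {V : Type*} [NormedAddCommGroup V] [NormedSpace ℝ V] [CompleteSpace V]

/-- A family of local diffeomorphisms of the line depending smoothly on a parameter has local
inverses depending smoothly on the parameter. -/
lemma exists_contDiffAt_inverse {H : V × ℝ → ℝ} {v : V} {t a : ℝ} (hH : ContDiffAt ℝ ∞ H (v, t))
    (ha : HasDerivAt (fun s => H (v, s)) a t) (ha0 : a ≠ 0) :
    ∃ K : V × ℝ → ℝ, ContDiffAt ℝ ∞ K (v, H (v, t)) ∧
      ∀ᶠ z in 𝓝 (v, t), K (z.1, H z) = z.2 := by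
  have hd := (hH.differentiableAt (by simp)).hasFDerivAt
  set L := fderiv ℝ H (v, t)
  have hL : ∀ s : ℝ, L (0, s) = s * a := by
    intro s
    have h1 : HasDerivAt (fun s : ℝ => (v, s)) ((0 : V), (1 : ℝ)) t :=
      (hasDerivAt_const t v).prodMk (hasDerivAt_id t)
    have h2 := (hd.comp_hasDerivAt t h1).unique ha
    rw [← h2, ← smul_eq_mul, ← map_smul]
    simp
  have hsplit : ∀ z : V × ℝ, L z = L (z.1, 0) + z.2 * a := by
    intro z
    rw [← hL, ← map_add]
    simp
  -- The derivative of $(v,t)\mapsto(v,H(v,t))$ is triangular with diagonal entries `1` and `a`, so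
  -- the inverse function theorem applies.
  let A : (V × ℝ) ≃L[ℝ] V × ℝ := ContinuousLinearEquiv.equivOfInverse
    ((ContinuousLinearMap.fst ℝ V ℝ).prod L)
    ((ContinuousLinearMap.fst ℝ V ℝ).prod (a⁻¹ • (ContinuousLinearMap.snd ℝ V ℝ -
      L.comp ((ContinuousLinearMap.inl ℝ V ℝ).comp (ContinuousLinearMap.fst ℝ V ℝ)))))
    (fun z => by
      refine Prod.ext rfl ?_
      simp [hsplit z]
      field_simp)
    (fun z => by
      refine Prod.ext rfl ?_
      simp
      rw [hsplit]
      field_simp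
      simp)
  have hT : ContDiffAt ℝ ∞ (fun z : V × ℝ => (z.1, H z)) (v, t) := contDiffAt_fst.prodMk hH
  have hT' : HasFDerivAt (fun z : V × ℝ => (z.1, H z)) (A : V × ℝ →L[ℝ] V × ℝ) (v, t) :=
    hasFDerivAt_fst.prodMk hd
  refine ⟨fun z => (hT.localInverse hT' (by simp) z).2,
    (hT.to_localInverse hT' (by simp)).snd, ?_⟩
  exact (hT.hasStrictFDerivAt' hT' (by simp)).eventually_left_inverse.mono
    fun z hz => congrArg Prod.snd hz

end Implicit

section Smooth

variable {S E : Type*} [TopologicalSpace S] [ChartedSpace (EuclideanHalfSpace 2) S]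
  [TopologicalSpace E]

/-- The charts of a covering space lifted from the base. -/
def liftedCharts (p : E → S) : Set (OpenPartialHomeomorph E (EuclideanHalfSpace 2)) :=
  {C | ∃ Φ : OpenPartialHomeomorph E S, EqOn Φ p Φ.source ∧
    ∃ D ∈ atlas (EuclideanHalfSpace 2) S, C = Φ.trans D}

lemma exists_mem_liftedCharts {p : E → S} (hp : IsLocalHomeomorph p) (e : E) :
    ∃ C ∈ liftedCharts p, e ∈ C.source := by
  obtain ⟨Φ, hΦ, rfl⟩ := hp e
  exact ⟨_, ⟨Φ, fun _ _ => rfl, _, chart_mem_atlas _ (Φ e), rfl⟩, by simp [hΦ]⟩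

end Smooth
-- Smooth maps to and from the half-space model of `N`
section HalfSpaceProd

lemma ContMDiffAt.prodMk_halfSpaceProd {V H M : Type*} [NormedAddCommGroup V] [NormedSpace ℝ V]
    [TopologicalSpace H] {J : ModelWithCorners ℝ V H} [TopologicalSpace M] [ChartedSpace H M]
    {f : M → EuclideanHalfSpace 2} {g : M → ℝ} {x : M} (hf : ContMDiffAt J (𝓡∂ 2) ∞ f x)
    (hg : ContMDiffAt J 𝓘(ℝ, ℝ) ∞ g x) :
    ContMDiffAt (M' := HalfSpaceProd) J ((𝓡∂ 2).prod 𝓘(ℝ, ℝ)) ∞ (fun y => (f y, g y)) x := by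
  have h := hf.prodMk hg
  rwa [chartedSpaceSelf_prod] at h

lemma contMDiffAt_fst_halfSpaceProd {z : HalfSpaceProd} :
    ContMDiffAt ((𝓡∂ 2).prod 𝓘(ℝ, ℝ)) (𝓡∂ 2) ∞ (fun w : HalfSpaceProd => w.1) z := by
  have h : ContMDiffAt ((𝓡∂ 2).prod 𝓘(ℝ, ℝ)) (𝓡∂ 2) ∞
      (@Prod.fst (EuclideanHalfSpace 2) ℝ) z := contMDiffAt_fst
  rwa [chartedSpaceSelf_prod] at h

lemma contMDiffAt_snd_halfSpaceProd {z : HalfSpaceProd} :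
    ContMDiffAt ((𝓡∂ 2).prod 𝓘(ℝ, ℝ)) 𝓘(ℝ, ℝ) ∞ (fun w : HalfSpaceProd => w.2) z := by
  have h : ContMDiffAt ((𝓡∂ 2).prod 𝓘(ℝ, ℝ)) 𝓘(ℝ, ℝ) ∞
      (@Prod.snd (EuclideanHalfSpace 2) ℝ) z := contMDiffAt_snd
  rwa [chartedSpaceSelf_prod] at h

end HalfSpaceProd

/-! ### Smoothness of the suspension foliation -/

section SmoothSuspension

variable {S N E G ι : Type*} [TopologicalSpace S] [ChartedSpace (EuclideanHalfSpace 2) S]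
  [TopologicalSpace E] [Group G] [MulAction G E] [Fintype ι] {p : E → S} {e₀ : E}
  {P : SheetPartition G p e₀ ι} {κ : G →* (I ≃ₜ I)} {ψ : E ≃ₜ E} {c : ℤ → G → G}
  {φ : S ≃ₘ^∞⟮𝓡∂ 2, 𝓡∂ 2⟯ S} {q : S × ℝ → N}

lemma contMDiff_zpow (φ : S ≃ₘ^∞⟮𝓡∂ 2, 𝓡∂ 2⟯ S) (n : ℤ) :
    ContMDiff (𝓡∂ 2) (𝓡∂ 2) ∞ ((φ.toEquiv : Equiv.Perm S) ^ n) := by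
  induction n using Int.induction_on with
  | zero => exact contMDiff_id
  | succ n ih =>
    rw [zpow_add_one]
    exact ih.comp φ.contMDiff
  | pred n ih =>
    rw [zpow_sub_one]
    exact ih.comp φ.symm.contMDiff

/-- Over a small open set the heights of the suspension of a well-tapered representation and their
inverses are smooth functions on the base. -/
lemma exists_contMDiffAt_suspensionHeight (hκ : ∀ g, Monotone (κ g))
    (hψ : ∀ e, p (ψ e) = φ (p e)) (ht : ∀ g, IsTaperedDiffeo (κ g)) (e : E) (t : ℝ) :
    ∃ F K : S × ℝ → ℝ,
      ContMDiffAt ((𝓡∂ 2).prod 𝓘(ℝ, ℝ)) 𝓘(ℝ, ℝ) ∞ F (p e, t) ∧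
      ContMDiffAt ((𝓡∂ 2).prod 𝓘(ℝ, ℝ)) 𝓘(ℝ, ℝ) ∞ K (p e, F (p e, t)) ∧
      (∀ᶠ z in 𝓝 (e, t), suspensionHeight P κ ψ z.1 z.2 = F (p z.1, z.2)) ∧
      ∀ᶠ z in 𝓝 (p e, t), K (z.1, F z) = z.2 := by
  set n := ⌊t⌋ with hn
  obtain ⟨g, hg⟩ := exists_fiberHeight_eq P (κ := κ) ((ψ ^ n) e)
  obtain ⟨g', hg'⟩ := exists_fiberHeight_eq P (κ := κ) ((ψ ^ (n - 1)) e)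
  -- The weights of the partition serve as free parameters in a vector space. The inverse function
  -- theorem is applied there and not on `S`, which has a boundary.
  let H : ((ι → ℝ) × (ι → ℝ)) × ℝ → ℝ := fun z =>
    z.2 + (∑ i, z.1.1 i * unitExtension (κ (g i)) (z.2 - n) - (z.2 - n)) +
      (∑ i, z.1.2 i * unitExtension (κ (g' i)) (z.2 - n + 1) - (z.2 - n + 1))
  let χ : ℤ → S → S := fun k => ⇑((φ.toEquiv : Equiv.Perm S) ^ k)
  let A : S → (ι → ℝ) × (ι → ℝ) := fun x =>
    (fun i => P.toFun i (χ n x), fun i => P.toFun i (χ (n - 1) x))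
  have hA : ContMDiff (𝓡∂ 2) 𝓘(ℝ, (ι → ℝ) × (ι → ℝ)) ∞ A := by
    refine ContMDiff.prodMk_space ?_ ?_ <;> refine contMDiff_pi_space.2 fun i => ?_
    · exact (P.contMDiff i).comp (contMDiff_zpow φ n)
    · exact (P.contMDiff i).comp (contMDiff_zpow φ (n - 1))
  have hu := fun g => contDiff_unitExtension (hκ g) (ht g)
  have hH : ContDiff ℝ ∞ H := by
    have h1 := fun i => hu (g i)
    have h2 := fun i => hu (g' i)
    fun_prop
  have hder : ∀ (k : G) (a : ℝ), HasDerivAt (fun s => unitExtension (κ k) (s - a))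
      (deriv (unitExtension (κ k)) (t - a)) t := fun k a =>
    (((hu k).differentiable (by simp) (t - a)).hasDerivAt).comp_sub_const t a
  have hpos : ∀ k s, 0 < deriv (unitExtension (κ k)) s := fun k s =>
    deriv_unitExtension_pos (hκ k) (by rw [← map_inv]; exact hκ _) (ht k)
      (by rw [← map_inv]; exact ht _) s
  set v := A (p e) with hv
  have hHt : HasDerivAt (fun s => H (v, s))
      (1 + (∑ i, v.1 i * deriv (unitExtension (κ (g i))) (t - n) - 1) +
        (∑ i, v.2 i * deriv (unitExtension (κ (g' i))) (t - (n - 1)) - 1)) t := by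
    refine ((hasDerivAt_id t).add ((HasDerivAt.fun_sum fun i _ =>
      (hder (g i) n).const_mul (v.1 i)).sub ((hasDerivAt_id t).sub_const _))).add
      (HasDerivAt.sub ?_ ?_)
    · refine HasDerivAt.fun_sum fun i _ => ?_
      have := (hder (g' i) (n - 1)).const_mul (v.2 i)
      simpa only [sub_sub_eq_add_sub, add_sub_right_comm] using this
    · exact ((hasDerivAt_id t).sub_const _).add_const _
  -- Since `n` is the integer part of `t`, the lower block is evaluated beyond its upper end, where
  -- all derivatives are `1`; only the positive sum from the upper block remains.
  have hB : ∑ i, v.2 i * deriv (unitExtension (κ (g' i))) (t - (n - 1)) = 1 := by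
    refine (Finset.sum_congr rfl fun i _ => ?_).trans (P.sum_eq_one (χ (n - 1) (p e)))
    rw [deriv_unitExtension_of_ge (hκ _) (ht _) (by have := Int.floor_le t; linarith), mul_one]
  have hApos : 0 < ∑ i, v.1 i * deriv (unitExtension (κ (g i))) (t - n) := by
    obtain ⟨j, hj⟩ : ∃ j, 0 < v.1 j := by
      by_contra! h
      have h1 : ∑ i, v.1 i ≤ 0 := Finset.sum_nonpos fun i _ => h i
      have h2 : ∑ i, v.1 i = 1 := P.sum_eq_one (χ n (p e))
      linarith
    exact Finset.sum_pos' (fun i _ => mul_nonneg (P.nonneg i _) (hpos _ _).le)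
      ⟨j, Finset.mem_univ j, mul_pos hj (hpos _ _)⟩
  obtain ⟨K, hK, hKH⟩ := exists_contDiffAt_inverse hH.contDiffAt hHt (by rw [hB]; linarith)
  have hAz : ∀ z : S × ℝ,
      ContMDiffAt ((𝓡∂ 2).prod 𝓘(ℝ, ℝ)) 𝓘(ℝ, ((ι → ℝ) × (ι → ℝ)) × ℝ) ∞
        (fun z : S × ℝ => (A z.1, z.2)) z := fun z =>
    ((hA.comp contMDiff_fst).prodMk_space contMDiff_snd).contMDiffAt
  refine ⟨fun z => H (A z.1, z.2), fun z => K (A z.1, z.2),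
    hH.contDiffAt.contMDiffAt.comp (p e, t) (hAz _), ?_, ?_, ?_⟩
  · exact ContMDiffAt.comp (p e, H (v, t)) (g := K) (f := fun z : S × ℝ => (A z.1, z.2))
      hK.contMDiffAt (hAz _)
  · have h1 := (((ψ ^ n).continuous.comp continuous_fst).continuousAt (x := (e, t))).eventually hg
    have h2 := (((ψ ^ (n - 1)).continuous.comp continuous_fst).continuousAt
      (x := (e, t))).eventually hg'
    have h3 : ∀ᶠ w : E × ℝ in 𝓝 (e, t), w.2 ∈ Ioo ((n : ℝ) - 1) (n + 1) :=
      continuous_snd.continuousAt.eventually (isOpen_Ioo.mem_nhds (mem_Ioo_floor t))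
    filter_upwards [h1, h2, h3] with z h1 h2 h3
    rw [suspensionHeight_eq P ψ hκ z.1 h3]
    simp only [Function.comp_apply] at h1 h2
    rw [h1, h2]
    simp only [proj_zpow (χ := φ.toEquiv) hψ]
    rfl
  · have hc : ContinuousAt (fun z : S × ℝ => (A z.1, z.2)) (p e, t) := (hAz _).continuousAt
    exact hc.eventually hKH

variable [IsManifold (𝓡∂ 2) ∞ S]
  [TopologicalSpace N] [ChartedSpace HalfSpaceProd N] [IsManifold ((𝓡∂ 2).prod 𝓘(ℝ, ℝ)) ∞ N]

/-- Near $q(x,r)$ a foliated chart reads $(D(x),K(x,r))$, and its inverse is $(d,t)\mapsto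
q(D^{-1}d,F(D^{-1}d,t))$, with `F` the height and `K` its inverse. -/
theorem isSmooth_foliation
    (h𝒞 : ∀ e, ∃ C ∈ liftedCharts p, e ∈ C.source)
    (hQ : IsFoliatedCover G (developingMap P κ ψ q) (deckHeight κ c))
    (hp : IsQuotientCoveringMap p G) (hκ : ∀ g, Monotone (κ g))
    (hψ : ∀ e, p (ψ e) = φ (p e)) (hq : IsMappingTorus φ q)
    (ht : ∀ g, IsTaperedDiffeo (κ g)) :
    (hQ.foliation h𝒞).IsSmooth := by
  rintro _ ⟨Φ, hΦ, _, ⟨Ψ, hΨ, D, hD, rfl⟩, rfl⟩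
  have hD' : D ∈ IsManifold.maximalAtlas (𝓡∂ 2) ∞ S := IsManifold.subset_maximalAtlas hD
  set ch := Φ.symm.trans ((Ψ.trans D).prod (OpenPartialHomeomorph.refl ℝ)) with hch
  refine OpenPartialHomeomorph.mem_maximalAtlas_of_contMDiffOn _ ?_ ?_
  · rintro _ hy
    refine ContMDiffAt.contMDiffWithinAt ?_
    obtain ⟨⟨e, t⟩, hz, he, rfl⟩ := (IsFoliatedCover.mem_chart_source hΦ).1 hy
    obtain ⟨F, K, hF, hK, hFz, hKz⟩ :=
      exists_contMDiffAt_suspensionHeight (P := P) hκ hψ ht e t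
    have he' : e ∈ Ψ.source ∧ Ψ e ∈ D.source := by simpa using he
    have hdiff := hq.localDiffeo (p e, F (p e, t))
    have hQe : developingMap P κ ψ q (e, t) = q (p e, F (p e, t)) := by
      rw [developingMap, hFz.self_of_nhds]
    have hΛ : hdiff.localInverse (q (p e, F (p e, t))) = (p e, F (p e, t)) :=
      hdiff.localInverse_left_inv hdiff.localInverse_mem_target
    have hpe : Ψ e = p e := hΨ he'.1
    rw [hpe] at he'
    refine ContMDiffAt.congr_of_eventuallyEq (M' := HalfSpaceProd)
      (f := fun y => (D (hdiff.localInverse y).1, K (hdiff.localInverse y))) ?_ ?_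
    · rw [hQe]
      have hΛs : ContMDiffAt ((𝓡∂ 2).prod 𝓘(ℝ, ℝ)) ((𝓡∂ 2).prod 𝓘(ℝ, ℝ)) ∞ hdiff.localInverse
        (q (p e, F (p e, t))) := hdiff.localInverse_contMDiffAt
      refine ContMDiffAt.prodMk_halfSpaceProd ?_ ?_
      · refine ContMDiffAt.comp (g := fun z : S × ℝ => D z.1) _ ?_ hΛs
        rw [hΛ]
        exact (contMDiffAt_of_mem_maximalAtlas hD' he'.2).comp (p e, F (p e, t)) contMDiffAt_fst
      · refine ContMDiffAt.comp (g := K) _ ?_ hΛs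
        rw [hΛ]
        exact hK
    · rw [EventuallyEq, ← hQ.isLocalHomeomorph.map_nhds_eq, eventually_map]
      have hpc : Continuous fun z : E × ℝ => (p z.1, z.2) := by
        have := hp.isCoveringMap.continuous
        fun_prop
      have hFc : ContinuousAt (fun z : E × ℝ => (p z.1, F (p z.1, z.2))) (e, t) :=
        (hp.isCoveringMap.continuous.comp continuous_fst).continuousAt.prodMk
          (hF.continuousAt.comp (x := (e, t)) (f := fun z : E × ℝ => (p z.1, z.2)) hpc.continuousAt)
      filter_upwards [Φ.open_source.mem_nhds hz, hFz,
        continuous_fst.continuousAt.eventually (Ψ.open_source.mem_nhds he'.1),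
        hpc.continuousAt.eventually hKz,
        hFc.eventually (hdiff.localInverse_eventuallyEq_left)] with z h1 h2 h3 h4 h5
      simp only [Function.comp_apply, id] at h5
      rw [hch, IsFoliatedCover.chart_apply hΦ _ h1, developingMap, h2, h5, h4,
        OpenPartialHomeomorph.trans_apply, hΨ h3]
  · rintro w₀ hw
    refine ContMDiffAt.contMDiffWithinAt ?_
    have hw' : (w₀.1 ∈ D.target ∧ D.symm w₀.1 ∈ Ψ.target) ∧ (Ψ.symm (D.symm w₀.1), w₀.2) ∈ Φ.source := by
      have hw' := hw
      simp only [hch, OpenPartialHomeomorph.trans_target, OpenPartialHomeomorph.prod_target,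
        OpenPartialHomeomorph.symm_target, mem_inter_iff, mem_preimage] at hw'
      exact ⟨hw'.1.1, hw'.2⟩
    obtain ⟨⟨ha, ha'⟩, ha''⟩ := hw'
    obtain ⟨F, K, hF, hK, hFz, hKz⟩ := exists_contMDiffAt_suspensionHeight (P := P) hκ hψ ht
      (Ψ.symm (D.symm w₀.1)) w₀.2
    have hpΨ : ∀ x ∈ Ψ.target, p (Ψ.symm x) = x := fun x hx => by
      rw [← hΨ (Ψ.map_target hx), Ψ.right_inv hx]
    rw [hpΨ _ ha'] at hF
    have hDs := contMDiffAt_symm_of_mem_maximalAtlas hD' ha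
    have hb : ContMDiffAt ((𝓡∂ 2).prod 𝓘(ℝ, ℝ)) (𝓡∂ 2) ∞ (fun w : HalfSpaceProd => D.symm w.1)
        w₀ := ContMDiffAt.comp (g := D.symm) w₀ hDs contMDiffAt_fst_halfSpaceProd
    have hDt : ContMDiffAt ((𝓡∂ 2).prod 𝓘(ℝ, ℝ)) ((𝓡∂ 2).prod 𝓘(ℝ, ℝ)) ∞
        (fun w : HalfSpaceProd => (D.symm w.1, w.2)) w₀ :=
      hb.prodMk contMDiffAt_snd_halfSpaceProd
    refine ContMDiffAt.congr_of_eventuallyEq (f := fun w : HalfSpaceProd =>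
      q (D.symm w.1, F (D.symm w.1, w.2))) ?_ ?_
    · exact (hq.localDiffeo _).contMDiffAt.comp w₀ (hb.prodMk (hF.comp w₀ hDt))
    · have hc : ContinuousAt (fun w : HalfSpaceProd => (Ψ.symm (D.symm w.1), w.2)) w₀ :=
        ((Ψ.symm.continuousAt ha').comp (x := w₀) (f := fun w : HalfSpaceProd => D.symm w.1)
          hb.continuousAt).prodMk continuous_snd.continuousAt
      filter_upwards [hc.eventually hFz, hc.eventually (Φ.open_source.mem_nhds ha''),
        hb.continuousAt.eventually (Ψ.open_target.mem_nhds ha')] with w h1 h2 h3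
      have h4 : ch.symm w = Φ (Ψ.symm (D.symm w.1), w.2) := rfl
      rw [h4, hΦ h2, developingMap, h1]
      dsimp only
      rw [hpΨ _ h3]

end SmoothSuspension

lemma IsCoveringMap.t2Space {S E : Type*} [TopologicalSpace S] [TopologicalSpace E] [T2Space S]
    {p : E → S} (hp : IsCoveringMap p) : T2Space E := by
  refine ⟨fun x y hxy => ?_⟩
  by_cases h : p x = p y
  · exact hp.isSeparatedMap x y h hxy
  · obtain ⟨U, V, hU, hV, hx, hy, hd⟩ := t2_separation h
    exact ⟨p ⁻¹' U, p ⁻¹' V, hU.preimage hp.continuous, hV.preimage hp.continuous, hx, hy,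
      hd.preimage p⟩

end

/-! ### The existence theorem -/

theorem lemma4p3 {S N : Type*}
    [TopologicalSpace S] [ChartedSpace (EuclideanHalfSpace 2) S] [IsManifold (𝓡∂ 2) ∞ S]
    (hS : IsPuncturedSurface S)
    (φ : S ≃ₘ^∞⟮𝓡∂ 2, 𝓡∂ 2⟯ S)
    [TopologicalSpace N] [ChartedSpace HalfSpaceProd N]
    [IsManifold ((𝓡∂ 2).prod 𝓘(ℝ, ℝ)) ∞ N]
    (q : S × ℝ → N) (hq : IsMappingTorus φ q)
    (x₀ : S) (ρ : FundamentalGroup S x₀ →* (I ≃ₜ I))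
    (hmono : ∀ γ, Monotone (ρ γ)) (hρ : IsGeneric ρ) :
    ∃ F : SurfaceFoliation N,
      F.IsTypical ∧ F.IsSuspension q ρ ∧ (IsWellTapered ρ → F.IsSmooth) := by
  obtain ⟨_, _, G, _, E, _, _, p, _, hp⟩ := hS.exists_contractible_covering
  have := hp.toContinuousConstSMul
  have := hp.isCoveringMap.t2Space
  obtain ⟨e₀, he₀⟩ := hp.surjective x₀
  let Θ : FundamentalGroup S x₀ ≃* Gᵐᵒᵖ := hp.fundamentalGroupEquiv ⟨e₀, he₀⟩
  -- Inversion converts the identification of the fundamental group with the opposite of `G` into a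
  -- homomorphism on `G`.
  let κ : G →* (I ≃ₜ I) := ρ.comp ((MulEquiv.inv' G).trans Θ.symm).toMonoidHom
  have hκ : ∀ g, Monotone (κ g) := fun g => hmono _
  have hgen : IsGeneric κ := fun g hg => hρ _ fun h =>
    hg (((MulEquiv.inv' G).trans Θ.symm).map_eq_one_iff.1 h)
  have hρκ : ∀ (γ : Path x₀ x₀) (L : C(I, E)) (g : G), L 0 = e₀ → (∀ s, p (L s) = γ s) →
      L 1 = g • e₀ → ρ (FundamentalGroup.fromPath (Path.Homotopic.Quotient.mk γ)) = κ g⁻¹ := by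
    intro γ L g h0 hL h1
    have hΘ : Θ (FundamentalGroup.fromPath (Path.Homotopic.Quotient.mk γ)) = MulOpposite.op g := by
      refine hp.fundamentalGroupToMulOpposite_apply_eq_Iff.2 ?_
      have h := (hp.isCoveringMap.eq_liftPath_iff' (γ := (γ : C(I, S))) (e := e₀)
        (γ.source.trans he₀.symm)).2 ⟨funext hL, h0⟩
      rw [MulOpposite.unop_op, ← h1, h]
      rfl
    change _ = ρ (Θ.symm (MulOpposite.op g⁻¹⁻¹))
    rw [inv_inv, ← hΘ, Θ.symm_apply_apply]
  obtain ⟨T, ⟨P⟩⟩ := exists_sheetPartition hp e₀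
  obtain ⟨ψ, hψ⟩ := hp.exists_homeomorph_lift φ.toHomeomorph
  choose c hc using fun n : ℤ => hp.exists_equivariance (ψ := ⇑(ψ ^ n)) (ψ ^ n).continuous
    (proj_zpow (χ := φ.toEquiv) hψ n)
  have hQ := isFoliatedCover_developingMap (P := P) hp hκ hgen hψ hc hq
  have h𝒞 := exists_mem_liftedCharts hp.isCoveringMap.isLocalHomeomorph
  refine ⟨hQ.foliation h𝒞, hQ.isTypical h𝒞 hp.disjoint,
    isSuspension_foliation h𝒞 hQ hp hκ hc he₀ ρ hρκ, fun h => ?_⟩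
  exact isSmooth_foliation h𝒞 hQ hp hκ hψ hq fun g => h.2 _
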